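/- **Theorem (PSPACE-hardness of degree lower bounds).** The *core language* over variables $X_1,\dots,X_n$, which store non-negative integers, has the expressions $X_i$, $X_i+X_k$, $X_i*X_k$ and the commands $$C ::= \mathtt{skip}\ \mid\ X_i:=E\ \mid\ C_1;C_2\ \mid\ \mathtt{loop}\ X_i\ \{C\}\ \mid\ \mathtt{choose}\ C_1\ \mathtt{or}\ C_2,$$ where $X_i$ may not be assigned in the body of $\mathtt{loop}\ X_i\ \{C\}$. The semantics of a command is a relation $[\![C]\!]\subseteq\mathbb N^n\times\mathbb N^n$ between initial and final states: $\mathtt{skip}$ is the identity, assignment and sequential composition are as usual, $[\![\mathtt{choose}\ C_1\ \mathtt{or}\ C_2]\!]=[\![C_1]\!]\cup[\![C_2]\!]$, and $[\![\mathtt{loop}\ X_i\ \{C\}]\!]=\{(\vec x,\vec y) : \exists m\le x_i,\ \vec x\,[\![C]\!]^m\,\vec y\}$. Let DEG be the set of triples $(P,j,d)$, where $P$ is a core-language program over $X_1,\dots,X_n$, $1\le j\le n$ and $d\in\mathbb N$, such that $$\max\{\,y_j : \langle x,\dots,x\rangle\,[\![P]\!]\,\vec y\,\}=\Omega(x^d)\qquad(x\to\infty).$$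 Triples are represented by strings in which $P$ is written in prefix notation and $d$, as well as $n$, $j$ and the variable indices, are written in unary. Then DEG is PSPACE-hard under polynomial-time many-one reductions: every language over a finite alphabet that is decided by a deterministic Turing machine in polynomial space reduces to DEG by a polynomial-time computable function. This remains true when the instances are restricted to triples whose program $P$ contains exactly one loop. -/

import Mathlib

namespace CoreLang

/-! ### The core language -/

/-- Expressions over the variables `X₁, …, Xₙ` (indexed by `Fin n`): `X`, `X + Y`, `X * Y`. -/
inductive Expr (n : ℕ) : Type
  | var (i : Fin n) : Expr n
  | add (i k : Fin n) : Expr n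
  | mul (i k : Fin n) : Expr n

/-- Commands of the core language over the variables `X₁, …, Xₙ`. -/
inductive Cmd (n : ℕ) : Type
  | skip : Cmd n
  | assign (i : Fin n) (e : Expr n) : Cmd n
  | seq (c₁ c₂ : Cmd n) : Cmd n
  | loop (i : Fin n) (c : Cmd n) : Cmd n
  | choose (c₁ c₂ : Cmd n) : Cmd n

/-- A program state: a tuple of non-negative integers. -/
abbrev State (n : ℕ) : Type := Fin n → ℕ

/-- The value of an expression in a state. -/
def Expr.eval {n : ℕ} : Expr n → State n → ℕ
  | .var i, x => x i
  | .add i k, x => x i + x k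
  | .mul i k, x => x i * x k

/-- The `m`-fold composition of a binary relation with itself; the identity for `m = 0`. -/
def relPow {S : Type} (R : S → S → Prop) : ℕ → S → S → Prop
  | 0 => fun x y => x = y
  | m + 1 => fun x y => ∃ z, relPow R m x z ∧ R z y

/-- The semantics of commands: `c.sem x y` means that `c`, started in the state `x`, can end in
the state `y`.  The body of `loop Xᵢ {c}` is repeated a non-deterministically chosen number of
times, bounded by the value of `Xᵢ` on entry to the loop. -/
def Cmd.sem {n : ℕ} : Cmd n → State n → State n → Prop
  | .skip => fun x y => y = x
  | .assign i e => fun x y => y = Function.update x i (e.eval x)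
  | .seq c₁ c₂ => fun x y => ∃ z, c₁.sem x z ∧ c₂.sem z y
  | .loop i c => fun x y => ∃ m ≤ x i, relPow c.sem m x y
  | .choose c₁ c₂ => fun x y => c₁.sem x y ∨ c₂.sem x y

/-- The variable `Xᵢ` is assigned somewhere in the command. -/
def Cmd.Assigns {n : ℕ} : Cmd n → Fin n → Prop
  | .skip, _ => False
  | .assign k _, i => k = i
  | .seq c₁ c₂, i => c₁.Assigns i ∨ c₂.Assigns i
  | .loop _ c, i => c.Assigns i
  | .choose c₁ c₂, i => c₁.Assigns i ∨ c₂.Assigns i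

/-- The syntactic stipulation of the core language: no loop-bound variable is assigned in the body
of its loop. -/
def Cmd.WellFormed {n : ℕ} : Cmd n → Prop
  | .skip => True
  | .assign _ _ => True
  | .seq c₁ c₂ => c₁.WellFormed ∧ c₂.WellFormed
  | .loop i c => ¬ c.Assigns i ∧ c.WellFormed
  | .choose c₁ c₂ => c₁.WellFormed ∧ c₂.WellFormed

/-- The number of loop commands that occur in a command (nested or not). -/
def Cmd.loopCount {n : ℕ} : Cmd n → ℕ
  | .skip => 0
  | .assign _ _ => 0
  | .seq c₁ c₂ => c₁.loopCount + c₂.loopCount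
  | .loop _ c => c.loopCount + 1
  | .choose c₁ c₂ => c₁.loopCount + c₂.loopCount

/-! ### The decision problem -/

/-- The possible final values of `Xⱼ` when `c` is run on the input `⟨x, x, …, x⟩`. -/
def finalValues {n : ℕ} (c : Cmd n) (j : Fin n) (x : ℕ) : Set ℕ :=
  {v | ∃ y : State n, c.sem (fun _ => x) y ∧ v = y j}

/-- The maximal final value of `Xⱼ` when `c` is run on the input `⟨x, x, …, x⟩`
(a maximum of a finite non-empty set, see `isGreatest_maxFinalValue`). -/
noncomputable def maxFinalValue {n : ℕ} (c : Cmd n) (j : Fin n) (x : ℕ) : ℕ :=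
  sSup (finalValues c j x)

theorem relPow_finite {S : Type} {R : S → S → Prop} (h : ∀ x, {y | R x y}.Finite) (m : ℕ) (x : S) :
    {y | relPow R m x y}.Finite := by
  induction m with
  | zero => exact (Set.finite_singleton x).subset fun y hy => Eq.symm hy
  | succ m ih =>
    refine (ih.biUnion fun z _ => h z).subset ?_
    rintro y ⟨z, hz, hy⟩
    exact Set.mem_biUnion hz hy

theorem Cmd.sem_finite {n : ℕ} (c : Cmd n) (x : State n) : {y | c.sem x y}.Finite := by
  induction c generalizing x with
  | skip => exact (Set.finite_singleton x).subset fun y hy => hy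
  | assign i e =>
    exact (Set.finite_singleton (Function.update x i (e.eval x))).subset fun y hy => hy
  | seq c₁ c₂ ih₁ ih₂ =>
    refine ((ih₁ x).biUnion fun z _ => ih₂ z).subset ?_
    rintro y ⟨z, hz, hy⟩
    exact Set.mem_biUnion hz hy
  | loop i c ih =>
    refine ((Set.finite_Iic (x i)).biUnion fun m _ => relPow_finite ih m x).subset ?_
    rintro y ⟨m, hm, hy⟩
    exact Set.mem_biUnion (Set.mem_Iic.2 hm) hy
  | choose c₁ c₂ ih₁ ih₂ =>
    refine ((ih₁ x).union (ih₂ x)).subset ?_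
    rintro y (hy | hy)
    · exact Or.inl hy
    · exact Or.inr hy

theorem Cmd.sem_total {n : ℕ} (c : Cmd n) (x : State n) : ∃ y, c.sem x y := by
  induction c generalizing x with
  | skip => exact ⟨x, rfl⟩
  | assign i e => exact ⟨_, rfl⟩
  | seq c₁ c₂ ih₁ ih₂ =>
    obtain ⟨z, hz⟩ := ih₁ x
    obtain ⟨y, hy⟩ := ih₂ z
    exact ⟨y, z, hz, hy⟩
  | loop i c ih => exact ⟨x, 0, Nat.zero_le _, rfl⟩
  | choose c₁ c₂ ih₁ ih₂ =>
    obtain ⟨y, hy⟩ := ih₁ x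
    exact ⟨y, Or.inl hy⟩

/-- The maximal final value is attained and is an upper bound. -/
theorem isGreatest_maxFinalValue {n : ℕ} (c : Cmd n) (j : Fin n) (x : ℕ) :
    IsGreatest (finalValues c j x) (maxFinalValue c j x) := by
  have hfin : (finalValues c j x).Finite := by
    refine ((c.sem_finite fun _ => x).image fun y => y j).subset ?_
    rintro v ⟨y, hy, rfl⟩
    exact ⟨y, hy, rfl⟩
  have hne : (finalValues c j x).Nonempty := by
    obtain ⟨y, hy⟩ := c.sem_total fun _ => x
    exact ⟨y j, y, hy, rfl⟩
  exact ⟨Nat.sSup_mem hne hfin.bddAbove, fun v hv => le_csSup hfin.bddAbove hv⟩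

/-- A triple `(P, j, d)`: a core-language program, a variable index and a degree. -/
structure Instance : Type where
  n : ℕ
  prog : Cmd n
  wellFormed : prog.WellFormed
  j : Fin n
  d : ℕ

/-- The problem DEG: the triples `(P, j, d)` such that the maximal final value of `Xⱼ`, as a
function of `x` in the input `⟨x, …, x⟩`, is `Ω(x ^ d)`. -/
def DEG : Set Instance :=
  {t | (fun x : ℕ => (x : ℝ) ^ t.d) =O[Filter.atTop]
    fun x : ℕ => (maxFinalValue t.prog t.j x : ℝ)}

/-! ### Representation of the triples as strings: numbers are written in unary, programs in
prefix notation -/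

/-- The symbols of the string representation. -/
inductive Sym : Type
  | tick | mark | var | add | mul | skip | assign | seq | loop | choose
  deriving DecidableEq

instance : Fintype Sym where
  elems := {.tick, .mark, .var, .add, .mul, .skip, .assign, .seq, .loop, .choose}
  complete := by intro x; cases x <;> decide

/-- Unary notation of a number, with an end mark. -/
def unary (k : ℕ) : List Sym := List.replicate k Sym.tick ++ [Sym.mark]

def Expr.encode {n : ℕ} : Expr n → List Sym
  | .var i => Sym.var :: unary i
  | .add i k => Sym.add :: (unary i ++ unary k)
  | .mul i k => Sym.mul :: (unary i ++ unary k)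

def Cmd.encode {n : ℕ} : Cmd n → List Sym
  | .skip => [Sym.skip]
  | .assign i e => Sym.assign :: (unary i ++ e.encode)
  | .seq c₁ c₂ => Sym.seq :: (c₁.encode ++ c₂.encode)
  | .loop i c => Sym.loop :: (unary i ++ c.encode)
  | .choose c₁ c₂ => Sym.choose :: (c₁.encode ++ c₂.encode)

def Instance.encode (t : Instance) : List Sym :=
  unary t.n ++ t.prog.encode ++ unary t.j ++ unary t.d

theorem unary_append_inj {a b : ℕ} {s t : List Sym} (h : unary a ++ s = unary b ++ t) :
    a = b ∧ s = t := by
  induction a generalizing b with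
  | zero => cases b <;> simp_all [unary, List.replicate_succ]
  | succ a ih =>
    cases b with
    | zero => simp [unary, List.replicate_succ] at h
    | succ b =>
      have := @ih b (by simpa [unary, List.replicate_succ] using h)
      simpa using this

theorem Expr.encode_append_inj {n : ℕ} {e f : Expr n} {s t : List Sym}
    (h : e.encode ++ s = f.encode ++ t) : e = f ∧ s = t := by
  cases e <;> cases f <;> simp only [Expr.encode, List.cons_append, List.cons.injEq,
    List.append_assoc, true_and, reduceCtorEq, false_and] at h
  · obtain ⟨h₁, h₂⟩ := unary_append_inj h
    exact ⟨by rw [Fin.ext h₁], h₂⟩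
  all_goals
    obtain ⟨h₁, h₂⟩ := unary_append_inj h
    obtain ⟨h₃, h₄⟩ := unary_append_inj h₂
    exact ⟨by rw [Fin.ext h₁, Fin.ext h₃], h₄⟩

theorem Cmd.encode_append_inj {n : ℕ} {c e : Cmd n} {s t : List Sym}
    (h : c.encode ++ s = e.encode ++ t) : c = e ∧ s = t := by
  induction c generalizing e s t with
  | skip =>
    cases e <;> simp_all [Cmd.encode]
  | assign i f =>
    cases e <;> simp only [Cmd.encode, List.cons_append, List.cons.injEq,
      List.append_assoc, true_and, reduceCtorEq, false_and] at h
    obtain ⟨h₁, h₂⟩ := unary_append_inj h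
    obtain ⟨h₃, h₄⟩ := Expr.encode_append_inj h₂
    exact ⟨by rw [Fin.ext h₁, h₃], h₄⟩
  | loop i f ih =>
    cases e <;> simp only [Cmd.encode, List.cons_append, List.cons.injEq,
      List.append_assoc, true_and, reduceCtorEq, false_and] at h
    obtain ⟨h₁, h₂⟩ := unary_append_inj h
    obtain ⟨h₃, h₄⟩ := ih h₂
    exact ⟨by rw [Fin.ext h₁, h₃], h₄⟩
  | seq c₁ c₂ ih₁ ih₂ =>
    cases e <;> simp only [Cmd.encode, List.cons_append, List.cons.injEq,
      List.append_assoc, true_and, reduceCtorEq, false_and] at h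
    obtain ⟨h₁, h₂⟩ := ih₁ h
    obtain ⟨h₃, h₄⟩ := ih₂ h₂
    exact ⟨by rw [h₁, h₃], h₄⟩
  | choose c₁ c₂ ih₁ ih₂ =>
    cases e <;> simp only [Cmd.encode, List.cons_append, List.cons.injEq,
      List.append_assoc, true_and, reduceCtorEq, false_and] at h
    obtain ⟨h₁, h₂⟩ := ih₁ h
    obtain ⟨h₃, h₄⟩ := ih₂ h₂
    exact ⟨by rw [h₁, h₃], h₄⟩

/-- Different triples have different representations. -/
theorem Instance.encode_injective : Function.Injective Instance.encode := by
  rintro ⟨n, c, hc, j, d⟩ ⟨n', c', hc', j', d'⟩ h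
  simp only [Instance.encode, List.append_assoc] at h
  obtain ⟨rfl, k₁⟩ := unary_append_inj h
  obtain ⟨rfl, k₂⟩ := Cmd.encode_append_inj k₁
  obtain ⟨k₃, k₄⟩ := unary_append_inj k₂
  obtain rfl := Fin.ext k₃
  have k₅ : unary d ++ [] = unary d' ++ [] := by simpa using k₄
  obtain ⟨rfl, -⟩ := unary_append_inj k₅
  rfl

/-- The triples whose program contains exactly one loop. -/
abbrev SingleLoopInstance : Type := {t : Instance // t.prog.loopCount = 1}

end CoreLang

/-! ### Polynomial space -/

namespace SpaceBounded

open Turing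

/-- A deterministic one-tape Turing machine with input alphabet `α`: a `TM0` machine with finitely
many tape symbols and states, an embedding of the input alphabet into the non-blank tape symbols,
and a set of accepting states (the blank and the initial state are the default elements). -/
structure Decider (α : Type) : Type 1 where
  Γ : Type
  Q : Type
  [inhabitedΓ : Inhabited Γ]
  [inhabitedQ : Inhabited Q]
  [finΓ : Fintype Γ]
  [finQ : Fintype Q]
  machine : TM0.Machine Γ Q
  inputSym : α ↪ Γ
  inputSym_ne_blank : ∀ a, inputSym a ≠ default
  accept : Set Q

attribute [instance] Decider.inhabitedΓ Decider.inhabitedQ Decider.finΓ Decider.finQ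

namespace Decider

variable {α : Type} (D : Decider α)

/-- The initial configuration: the input on the tape, the head on its first symbol. -/
def init (w : List α) : TM0.Cfg D.Γ D.Q := TM0.init (w.map D.inputSym)

/-- The displacement of the head caused by an action. -/
def shift : TM0.Stmt D.Γ → ℤ
  | .move .left => -1
  | .move .right => 1
  | .write _ => 0

/-- `D.Trace w c z`: the computation on the input `w` passes through the configuration `c`, at
which moment the head is on the cell number `z` (the input starts in the cell number `0`). -/
inductive Trace (w : List α) : TM0.Cfg D.Γ D.Q → ℤ → Prop
  | start : Trace w (D.init w) 0
  | next {c c' : TM0.Cfg D.Γ D.Q} {z : ℤ} {q : D.Q} {a : TM0.Stmt D.Γ} :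
      Trace w c z → D.machine c.q c.Tape.head = some (q, a) → TM0.step D.machine c = some c' →
      Trace w c' (z + D.shift a)

/-- `D` halts on every input, and it halts in an accepting state exactly on the words of `L`. -/
def Decides (L : Language α) : Prop :=
  ∀ w : List α, ∃ c : TM0.Cfg D.Γ D.Q, TM0.Reaches D.machine (D.init w) c ∧
    TM0.step D.machine c = none ∧ (w ∈ L ↔ c.q ∈ D.accept)

/-- On every input `w`, the head only visits cells in the interval `[-s |w|, s |w|]`. -/
def RunsInSpace (s : ℕ → ℕ) : Prop :=
  ∀ (w : List α) (c : TM0.Cfg D.Γ D.Q) (z : ℤ), D.Trace w c z → |z| ≤ (s w.length : ℤ)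

end Decider

/-- The class PSPACE: languages decided by a deterministic Turing machine in polynomial space. -/
def PSPACE (α : Type) : Set (Language α) :=
  {L | ∃ (D : Decider α) (p : Polynomial ℕ),
    D.Decides L ∧ D.RunsInSpace fun m => p.eval m}

/-- The problem `A`, whose instances of type `β` are represented by strings through `enc`, is
PSPACE-hard: every language in PSPACE, over any finite alphabet, has a polynomial-time many-one
reduction to it. -/
def PSPACEHard {β S : Type} [Fintype S] (enc : β → List S) (A : Set β) : Prop :=
  ∀ (α : Type) [Fintype α] (L : Language α), L ∈ PSPACE α →
    ∃ f : List α → β,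
      Nonempty (TM2ComputableInPolyTime (fun w : List α => w) enc f) ∧ ∀ w, w ∈ L ↔ f w ∈ A

end SpaceBounded

/-!
A deterministic machine that works in polynomial space is simulated by a length-preserving
rewriting system, and the rewriting system by a core-language program with a single loop, whose
degree of growth tells whether the machine accepts.

*Machines and words.*  A configuration is written as a word with one letter per cell; the letter
for the scanned cell also contains the state.  The rules replace pairs of neighbouring letters, so
that each step of the machine is one step of rewriting, and nothing else is possible
(`Decider.Reachable.pstep`).  In an accepting halting configuration a marker appears, which spreads
over the word.  Hence the input is accepted if and only if the initial word can be rewritten to a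
word that consists of markers only (`Decider.mem_iff_reaches`).

*Words and programs.*  On the input `⟨x, …, x⟩` a letter at a position is represented by one
variable for each possible letter: the variable of the actual letter has the value `x ^ 2`, all
others have the value `x`.  The loop body guesses a rule and a position and applies the rule by
copying and resetting variables.  The program cannot test whether the left-hand side of the rule is
present, but if it is not, the value `x ^ 2` at that position is lost for ever, since the body
contains only copies.  So the body simulates rewriting of *partial* words exactly (`Rep.rule`).  A
final product over all positions has the degree `4 * J + 1` if the marker is everywhere, and a
smaller degree otherwise.  The loop runs at most `x` times, which is no restriction, because the
length of the computation does not depend on `x` (`exists_relPow`).  This gives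
`toInstance_mem_DEG_iff`.

*Computing the reduction.*  The text of the program consists of blocks that depend on a position
`i` only through numbers of the form `k + i * G` in unary notation (`encode_toInstance`).  It is
written by a program in a small structured language of stack machines with `push` and
loop-until-empty, which compiles to `TM2` machines (`Prog.toTM2`); a calculus of running times
(`Prog.Runs`, `Does`) yields the polynomial bound (`does_generator`).
-/

/-! ### Structured stack programs and their compilation to `TM2` machines -/

namespace StackProgram

open Turing Function

section

variable {K : Type}

/-- Structured programs on finitely many stacks.  `popLoop k body` pops the stack `k` until it is
empty and runs `body a` after each popped symbol `a`. -/
inductive Prog (Γ : K → Type) : Type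
  | skip : Prog Γ
  | push (k : K) (a : Γ k) : Prog Γ
  | seq (p q : Prog Γ) : Prog Γ
  | popLoop (k : K) (body : Γ k → Prog Γ) : Prog Γ

namespace Prog

variable {Γ : K → Type}

/-- The control points of a program. -/
def Label : Prog Γ → Type
  | skip => Unit
  | push _ _ => Unit
  | seq p q => p.Label ⊕ q.Label
  | popLoop k body => Option (Σ a : Γ k, (body a).Label)

/-- The control point at which a program starts. -/
def entry : (p : Prog Γ) → p.Label
  | skip => ()
  | push _ _ => ()
  | seq p _ => Sum.inl p.entry
  | popLoop _ _ => none

theorem finite_label [∀ k, Finite (Γ k)] (p : Prog Γ) : Finite p.Label := by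
  induction p with
  | skip => exact inferInstanceAs (Finite Unit)
  | push => exact inferInstanceAs (Finite Unit)
  | seq p q hp hq => exact inferInstanceAs (Finite (p.Label ⊕ q.Label))
  | popLoop k body h => exact inferInstanceAs (Finite (Option (Σ a : Γ k, (body a).Label)))

/-- The `TM2` statements at the control points of a program, when the control points are embedded
in the labels of a machine by `inj` and the control is to be passed to `next` at the end.  The
machine's internal state is itself a label: a pop stores in it the label to jump to. -/
def code {Λ : Type} : (p : Prog Γ) → (p.Label → Λ) → Λ → p.Label → TM2.Stmt Γ Λ Λ
  | skip, _, next => fun _ => .goto fun _ => next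
  | push k a, _, next => fun _ => .push k (fun _ => a) (.goto fun _ => next)
  | seq p q, inj, next => fun l : p.Label ⊕ q.Label =>
    l.elim (p.code (fun l => inj (Sum.inl l)) (inj (Sum.inr q.entry)))
      (q.code (fun l => inj (Sum.inr l)) next)
  | popLoop k body, inj, next => fun l : Option (Σ a : Γ k, (body a).Label) =>
    l.elim
      (.pop k (fun _ o => o.elim next fun a => inj (some ⟨a, (body a).entry⟩)) (.goto fun v => v))
      fun l => (body l.1).code (fun l' => inj (some ⟨l.1, l'⟩)) (inj none) l.2

variable [DecidableEq K]

/-- The machine `M` goes from the configuration `c` to the configuration `c'` in `n` steps. -/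
def Steps {Λ : Type} (M : Λ → TM2.Stmt Γ Λ Λ) (n : ℕ) (c c' : TM2.Cfg Γ Λ Λ) : Prop :=
  (flip bind (TM2.step M))^[n] (some c) = some c'

theorem Steps.trans {Λ : Type} {M : Λ → TM2.Stmt Γ Λ Λ} {m n : ℕ} {a b c : TM2.Cfg Γ Λ Λ}
    (h₁ : Steps M m a b) (h₂ : Steps M n b c) : Steps M (m + n) a c := by
  unfold Steps at *
  rw [Nat.add_comm, iterate_add_apply, h₁, h₂]

theorem Steps.one {Λ : Type} {M : Λ → TM2.Stmt Γ Λ Λ} {a b : TM2.Cfg Γ Λ Λ}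
    (h : TM2.step M a = some b) : Steps M 1 a b := h

/-- `p.Runs S S' t`: the program `p`, compiled into any machine, transforms the stacks `S` into the
stacks `S'` in at most `t` steps. -/
def Runs (p : Prog Γ) (S S' : ∀ k, List (Γ k)) (t : ℕ) : Prop :=
  ∀ (Λ : Type) (M : Λ → TM2.Stmt Γ Λ Λ) (inj : p.Label → Λ) (next : Λ),
    (∀ l, M (inj l) = p.code inj next l) →
    ∀ v, ∃ v' n, n ≤ t ∧ Steps M n ⟨some (inj p.entry), v, S⟩ ⟨some next, v', S'⟩

theorem Runs.mono {p : Prog Γ} {S S' : ∀ k, List (Γ k)} {t t' : ℕ} (h : p.Runs S S' t)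
    (ht : t ≤ t') : p.Runs S S' t' := by
  intro Λ M inj next hM v
  obtain ⟨v', n, hn, h⟩ := h Λ M inj next hM v
  exact ⟨v', n, hn.trans ht, h⟩

theorem runs_skip (S : ∀ k, List (Γ k)) : (skip : Prog Γ).Runs S S 1 := by
  intro Λ M inj next hM v
  refine ⟨v, 1, le_rfl, Steps.one ?_⟩
  simp [hM, code]

theorem runs_push (k : K) (a : Γ k) (S : ∀ k, List (Γ k)) :
    (push k a).Runs S (update S k (a :: S k)) 1 := by
  intro Λ M inj next hM v
  refine ⟨v, 1, le_rfl, Steps.one ?_⟩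
  simp [hM, code]

theorem Runs.seq {p q : Prog Γ} {S S' S'' : ∀ k, List (Γ k)} {t t' : ℕ} (hp : p.Runs S S' t)
    (hq : q.Runs S' S'' t') : (p.seq q).Runs S S'' (t + t') := by
  intro Λ M inj next hM v
  obtain ⟨v', n, hn, h⟩ := hp Λ M (fun l => inj (Sum.inl l)) (inj (Sum.inr q.entry))
    (fun l => hM (Sum.inl l)) v
  obtain ⟨v'', n', hn', h'⟩ := hq Λ M (fun l => inj (Sum.inr l)) next
    (fun l => hM (Sum.inr l)) v'
  exact ⟨v'', n + n', add_le_add hn hn', h.trans h'⟩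

theorem runs_popLoop_nil {k : K} {body : Γ k → Prog Γ} {S : ∀ k, List (Γ k)} (h : S k = []) :
    (popLoop k body).Runs S S 1 := by
  intro Λ M inj next hM v
  refine ⟨next, 1, le_rfl, Steps.one ?_⟩
  have hu : update S k [] = S := by rw [← h, update_eq_self]
  have := hM none
  simp only [code, Option.elim_none] at this
  simp [entry, this, h, hu]

theorem runs_popLoop_cons {k : K} {body : Γ k → Prog Γ} {S S' S'' : ∀ k, List (Γ k)} {a : Γ k}
    {l : List (Γ k)} {t t' : ℕ} (h : S k = a :: l) (hb : (body a).Runs (update S k l) S' t)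
    (hl : (popLoop k body).Runs S' S'' t') : (popLoop k body).Runs S S'' (1 + t + t') := by
  intro Λ M inj next hM v
  obtain ⟨v', n, hn, h'⟩ := hb Λ M (fun l => inj (some ⟨a, l⟩)) (inj none)
    (fun l => hM (some ⟨a, l⟩)) (inj (some ⟨a, (body a).entry⟩))
  obtain ⟨v'', n', hn', h''⟩ := hl Λ M inj next hM v'
  refine ⟨v'', 1 + n + n', by omega, ((Steps.one ?_).trans h').trans h''⟩
  have := hM none
  simp only [code, Option.elim_none] at this
  simp [entry, this, h]

/-- The rule for loops: `F l` describes the stacks at the moment when `l` remains on the stack `k`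
that drives the loop. -/
theorem runs_popLoop {k : K} {body : Γ k → Prog Γ} {t : ℕ} (F : List (Γ k) → ∀ k, List (Γ k))
    (L : List (Γ k)) (hF : ∀ l, l <:+ L → F l k = l)
    (hb : ∀ a l, a :: l <:+ L → (body a).Runs (update (F (a :: l)) k l) (F l) t) :
    (popLoop k body).Runs (F L) (F []) (L.length * (t + 1) + 1) := by
  induction L with
  | nil => simpa using runs_popLoop_nil (hF [] List.suffix_rfl)
  | cons a l ih =>
    have ih := ih (fun l' hl' => hF l' (hl'.trans (List.suffix_cons a l)))
      fun b l' hl' => hb b l' (hl'.trans (List.suffix_cons a l))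
    refine (runs_popLoop_cons (hF _ List.suffix_rfl) (hb a l List.suffix_rfl) ih).mono ?_
    simp only [List.length_cons]
    linarith

/-- The machine that runs the program `p` and halts; `k₀` and `k₁` hold its input and output. -/
noncomputable def toTM2 [Fintype K] [∀ k, Fintype (Γ k)] (p : Prog Γ) (k₀ k₁ : K) : FinTM2 where
  K := K
  k₀ := k₀
  k₁ := k₁
  Γ := Γ
  Λ := Option p.Label
  main := some p.entry
  ΛFin := by
    haveI := p.finite_label
    exact Fintype.ofFinite _
  σ := Option p.Label
  initialState := some p.entry
  σFin := by
    haveI := p.finite_label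
    exact Fintype.ofFinite _
  m l := l.elim (.load (fun _ => some p.entry) .halt) (p.code some none)

/-- The initial and final stacks of `FinTM2`, which are defined by a cast, as an `update`. -/
theorem dite_stack_eq_update (k₀ : K) (l : List (Γ k₀)) :
    (fun k => if h : k = k₀ then (by rw [h]; exact l) else []) =
      update (fun k => ([] : List (Γ k))) k₀ l := by
  funext k
  by_cases hk : k = k₀
  · subst hk
    simp
  · simp [hk]

/-- One more step halts the machine; it also resets the internal state, as an output
configuration must have the initial state. -/
theorem Runs.outputsInTime [Fintype K] [∀ k, Fintype (Γ k)] {p : Prog Γ} {k₀ k₁ : K}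
    {l : List (Γ k₀)} {l' : List (Γ k₁)} {t : ℕ}
    (h : p.Runs (update (fun _ => []) k₀ l) (update (fun _ => []) k₁ l') t) :
    Nonempty (TM2OutputsInTime (p.toTM2 k₀ k₁) l (some l') (t + 1)) := by
  obtain ⟨v', n, hn, h⟩ := h (Option p.Label) (p.toTM2 k₀ k₁).m some none (fun _ => rfl)
    (some p.entry)
  refine ⟨⟨⟨n + 1, ?_⟩, Nat.succ_le_succ hn⟩⟩
  have h₁ : Steps (p.toTM2 k₀ k₁).m 1 ⟨some none, v', update (fun _ => []) k₁ l'⟩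
      ⟨none, some p.entry, update (fun _ => []) k₁ l'⟩ := Steps.one rfl
  have h₂ := h.trans h₁
  have e₁ : initList (p.toTM2 k₀ k₁) l =
      ⟨some (some p.entry), some p.entry, update (fun _ => []) k₀ l⟩ :=
    congrArg (TM2.Cfg.mk (some (some p.entry)) (some p.entry)) (dite_stack_eq_update k₀ l)
  have e₂ : haltList (p.toTM2 k₀ k₁) l' =
      ⟨none, some p.entry, update (fun _ => []) k₁ l'⟩ :=
    congrArg (TM2.Cfg.mk none (some p.entry)) (dite_stack_eq_update k₁ l')
  change (flip bind (TM2.step (p.toTM2 k₀ k₁).m))^[n + 1] (some (initList (p.toTM2 k₀ k₁) l)) =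
    some (haltList (p.toTM2 k₀ k₁) l')
  erw [e₁, e₂]
  exact h₂

end Prog

end

end StackProgram

/-! ### Straight-line assignments, sequences and choices -/

namespace CoreLang

/-- The commands of the list in sequence. -/
def seqList {n : ℕ} (l : List (Cmd n)) : Cmd n := l.foldr Cmd.seq Cmd.skip

/-- The choice between the commands of the list and `skip`. -/
def chooseList {n : ℕ} (l : List (Cmd n)) : Cmd n := l.foldr Cmd.choose Cmd.skip

theorem sem_chooseList {n : ℕ} (l : List (Cmd n)) (x y : State n) :
    (chooseList l).sem x y ↔ (∃ c ∈ l, c.sem x y) ∨ y = x := by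
  induction l with
  | nil => simp [chooseList, Cmd.sem]
  | cons c l ih =>
    have : (chooseList (c :: l)).sem x y ↔ c.sem x y ∨ (chooseList l).sem x y := Iff.rfl
    rw [this, ih]
    simp [or_assoc]

/-- The state reached from `x` by a sequence of assignments. -/
def runAssigns {n : ℕ} (l : List (Fin n × Expr n)) (x : State n) : State n :=
  l.foldl (fun y a => Function.update y a.1 (a.2.eval y)) x

/-- The sequence of assignments, as a list of commands. -/
def assigns {n : ℕ} (l : List (Fin n × Expr n)) : List (Cmd n) :=
  l.map fun a => Cmd.assign a.1 a.2

theorem sem_assigns {n : ℕ} (l : List (Fin n × Expr n)) (x y : State n) :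
    (seqList (assigns l)).sem x y ↔ y = runAssigns l x := by
  induction l generalizing x with
  | nil => exact Iff.rfl
  | cons a l ih =>
    have : (seqList (assigns (a :: l))).sem x y ↔
        ∃ z, z = Function.update x a.1 (a.2.eval x) ∧ (seqList (assigns l)).sem z y := Iff.rfl
    rw [this]
    simp [ih, runAssigns]

theorem runAssigns_cons {n : ℕ} (a : Fin n × Expr n) (l : List (Fin n × Expr n)) (x : State n) :
    runAssigns (a :: l) x = runAssigns l (Function.update x a.1 (a.2.eval x)) := rfl

theorem runAssigns_append {n : ℕ} (l l' : List (Fin n × Expr n)) (x : State n) :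
    runAssigns (l ++ l') x = runAssigns l' (runAssigns l x) := by
  simp [runAssigns]

/-- The symbols of the elements of a list, each preceded by `s`, and then `skip`. -/
theorem encode_seqList {n : ℕ} (l : List (Cmd n)) :
    (seqList l).encode = l.flatMap (fun c => Sym.seq :: c.encode) ++ [Sym.skip] := by
  induction l with
  | nil => rfl
  | cons c l ih =>
    have : (seqList (c :: l)).encode = Sym.seq :: (c.encode ++ (seqList l).encode) := rfl
    rw [this, ih]
    simp

theorem encode_chooseList {n : ℕ} (l : List (Cmd n)) :
    (chooseList l).encode = l.flatMap (fun c => Sym.choose :: c.encode) ++ [Sym.skip] := by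
  induction l with
  | nil => rfl
  | cons c l ih =>
    have : (chooseList (c :: l)).encode = Sym.choose :: (c.encode ++ (chooseList l).encode) := rfl
    rw [this, ih]
    simp

theorem loopCount_seqList_assigns {n : ℕ} (l : List (Fin n × Expr n)) :
    (seqList (assigns l)).loopCount = 0 := by
  induction l with
  | nil => rfl
  | cons a l ih => exact (Nat.zero_add _).trans ih

theorem loopCount_chooseList {n : ℕ} (l : List (Cmd n)) (h : ∀ c ∈ l, c.loopCount = 0) :
    (chooseList l).loopCount = 0 := by
  induction l with
  | nil => rfl
  | cons c l ih =>
    have : (chooseList (c :: l)).loopCount = c.loopCount + (chooseList l).loopCount := rfl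
    rw [this, h c List.mem_cons_self, ih fun c hc => h c (List.mem_cons_of_mem _ hc)]

theorem wellFormed_seqList_assigns {n : ℕ} (l : List (Fin n × Expr n)) :
    (seqList (assigns l)).WellFormed := by
  induction l with
  | nil => trivial
  | cons a l ih => exact ⟨trivial, ih⟩

theorem wellFormed_chooseList {n : ℕ} (l : List (Cmd n)) (h : ∀ c ∈ l, c.WellFormed) :
    (chooseList l).WellFormed := by
  induction l with
  | nil => trivial
  | cons c l ih =>
    exact ⟨h c List.mem_cons_self, ih fun c hc => h c (List.mem_cons_of_mem _ hc)⟩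

theorem assigns_seqList_assigns {n : ℕ} (l : List (Fin n × Expr n)) (i : Fin n) :
    (seqList (assigns l)).Assigns i ↔ ∃ a ∈ l, a.1 = i := by
  induction l with
  | nil => simp [seqList, assigns, Cmd.Assigns]
  | cons a l ih =>
    have : (seqList (assigns (a :: l))).Assigns i ↔
        a.1 = i ∨ (seqList (assigns l)).Assigns i := Iff.rfl
    rw [this, ih]
    simp

theorem assigns_chooseList {n : ℕ} (l : List (Cmd n)) (i : Fin n) :
    (chooseList l).Assigns i ↔ ∃ c ∈ l, c.Assigns i := by
  induction l with
  | nil => simp [chooseList, Cmd.Assigns]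
  | cons c l ih =>
    have : (chooseList (c :: l)).Assigns i ↔ c.Assigns i ∨ (chooseList l).Assigns i := Iff.rfl
    rw [this, ih]
    simp

end CoreLang

/-! ### The program that simulates a rewriting system -/

namespace CoreLang

namespace Rewriting

open Relation

section

variable {A : Type} [Fintype A]

/-- The number of variables used for words with positions `0, …, J`. -/
abbrev numVars (A : Type) [Fintype A] (J : ℕ) : ℕ := Fintype.card A * (J + 1) + 2

/-- The variable that keeps the input value `x`; it also bounds the loop. -/
def zeroVar (A : Type) [Fintype A] (J : ℕ) : Fin (numVars A J) := Fin.ofNat _ 0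

/-- The variable for temporary results and for the final result. -/
def resVar (A : Type) [Fintype A] (J : ℕ) : Fin (numVars A J) := Fin.ofNat _ 1

/-- The number of a letter. -/
noncomputable def letterIndex (b : A) : ℕ := (Fintype.equivFin A b : ℕ)

/-- The variable that is quadratic in the input exactly if the letter `b` is at position `i`. -/
noncomputable def cellVar (J i : ℕ) (b : A) : Fin (numVars A J) :=
  Fin.ofNat _ (2 + letterIndex b + i * Fintype.card A)

theorem val_zeroVar (J : ℕ) : (zeroVar A J : ℕ) = 0 := rfl

theorem val_resVar (J : ℕ) : (resVar A J : ℕ) = 1 :=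
  Nat.mod_eq_of_lt (by simp [numVars])

theorem val_cellVar {J i : ℕ} (hi : i ≤ J) (b : A) :
    (cellVar J i b : ℕ) = 2 + letterIndex b + i * Fintype.card A := by
  refine Nat.mod_eq_of_lt ?_
  have h₁ : letterIndex b < Fintype.card A := (Fintype.equivFin A b).isLt
  have h₂ : i * Fintype.card A ≤ Fintype.card A * J := by
    rw [Nat.mul_comm]
    exact Nat.mul_le_mul_left _ hi
  rw [numVars, Nat.mul_add]
  omega

theorem cellVar_inj {J i i' : ℕ} (hi : i ≤ J) (hi' : i' ≤ J) {b b' : A} :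
    cellVar J i b = cellVar J i' b' ↔ i = i' ∧ b = b' := by
  refine ⟨fun h => ?_, fun h => by rw [h.1, h.2]⟩
  have h := congrArg Fin.val h
  rw [val_cellVar hi, val_cellVar hi'] at h
  have h₁ : letterIndex b < Fintype.card A := (Fintype.equivFin A b).isLt
  have h₂ : letterIndex b' < Fintype.card A := (Fintype.equivFin A b').isLt
  have hii : i = i' := by
    rcases lt_trichotomy i i' with hlt | heq | hlt
    · have := Nat.mul_le_mul_right (Fintype.card A) (Nat.succ_le_of_lt hlt)
      rw [Nat.succ_mul] at this
      omega
    · exact heq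
    · have := Nat.mul_le_mul_right (Fintype.card A) (Nat.succ_le_of_lt hlt)
      rw [Nat.succ_mul] at this
      omega
  subst hii
  refine ⟨rfl, (Fintype.equivFin A).injective (Fin.ext ?_)⟩
  simpa [letterIndex] using h

theorem cellVar_ne_zeroVar {J i : ℕ} (hi : i ≤ J) (b : A) : cellVar J i b ≠ zeroVar A J := by
  intro h
  have h := congrArg Fin.val h
  rw [val_cellVar hi, val_zeroVar] at h
  omega

theorem cellVar_ne_resVar {J i : ℕ} (hi : i ≤ J) (b : A) : cellVar J i b ≠ resVar A J := by
  intro h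
  have h := congrArg Fin.val h
  rw [val_cellVar hi, val_resVar] at h
  omega

theorem resVar_ne_zeroVar (J : ℕ) : resVar A J ≠ zeroVar A J := by
  intro h
  have h := congrArg Fin.val h
  rw [val_resVar, val_zeroVar] at h
  omega

/-- If the letter `u` is at position `i`, replace it by `v`, otherwise leave the position without
any letter: the assignments move the value of the variable for `u` to the variable for `v`, and
reset all the other variables of the position. -/
noncomputable def slotAssigns (J i : ℕ) (u v : A) :
    List (Fin (numVars A J) × Expr (numVars A J)) :=
  (resVar A J, .var (cellVar J i u)) ::
    ((Finset.univ : Finset A).toList.map (fun b => (cellVar J i b, .var (zeroVar A J))) ++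
      [(cellVar J i v, .var (resVar A J))])

/-- The assignments for the application of the rule `r.1.1 r.1.2 → r.2.1 r.2.2` at the positions
`i` and `i + 1`. -/
noncomputable def ruleAssigns (J i : ℕ) (r : (A × A) × (A × A)) :
    List (Fin (numVars A J) × Expr (numVars A J)) :=
  slotAssigns J i r.1.1 r.2.1 ++ slotAssigns J (i + 1) r.1.2 r.2.2

/-- The assignments that set up the word `u`. -/
noncomputable def initAssigns (J : ℕ) (u : ℕ → A) :
    List (Fin (numVars A J) × Expr (numVars A J)) :=
  (List.range (J + 1)).map fun i => (cellVar J i (u i), .mul (zeroVar A J) (zeroVar A J))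

/-- The assignments that multiply, over all pairs of neighbouring positions, the variables that
say that the letter `a` is there. -/
noncomputable def finalAssigns (J : ℕ) (a : A) :
    List (Fin (numVars A J) × Expr (numVars A J)) :=
  (resVar A J, .var (zeroVar A J)) :: (List.range J).flatMap fun i =>
    [(resVar A J, .mul (resVar A J) (cellVar J i a)),
      (resVar A J, .mul (resVar A J) (cellVar J (i + 1) a))]

/-- One step of rewriting, chosen among all rules and positions. -/
noncomputable def body (J : ℕ) (rules : List ((A × A) × (A × A))) : Cmd (numVars A J) :=
  chooseList ((List.range J).flatMap fun i =>
    rules.map fun r => seqList (assigns (ruleAssigns J i r)))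

/-- The program that rewrites the word `u` and tests whether it has become a power of `a`. -/
noncomputable def prog (J : ℕ) (rules : List ((A × A) × (A × A))) (u : ℕ → A) (a : A) :
    Cmd (numVars A J) :=
  .seq (seqList (assigns (initAssigns J u)))
    (.seq (.loop (zeroVar A J) (body J rules)) (seqList (assigns (finalAssigns J a))))

theorem fst_ne_zeroVar_of_mem_slotAssigns {J i : ℕ} (hi : i ≤ J) {u v : A}
    {p : Fin (numVars A J) × Expr (numVars A J)} (hp : p ∈ slotAssigns J i u v) :
    p.1 ≠ zeroVar A J := by
  simp only [slotAssigns, List.mem_cons, List.mem_append, List.mem_map, List.not_mem_nil,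
    or_false] at hp
  rcases hp with rfl | ⟨b, -, rfl⟩ | rfl
  · exact resVar_ne_zeroVar J
  · exact cellVar_ne_zeroVar hi b
  · exact cellVar_ne_zeroVar hi v

theorem not_assigns_body (J : ℕ) (rules : List ((A × A) × (A × A))) :
    ¬ (body J rules).Assigns (zeroVar A J) := by
  rw [body, assigns_chooseList]
  rintro ⟨c, hc, h⟩
  obtain ⟨i, hi, r, -, rfl⟩ : ∃ i < J, ∃ r ∈ rules, seqList (assigns (ruleAssigns J i r)) = c := by
    simpa using hc
  obtain ⟨p, hp, h⟩ := (assigns_seqList_assigns _ _).1 h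
  rcases List.mem_append.1 hp with hp | hp
  · exact fst_ne_zeroVar_of_mem_slotAssigns hi.le hp h
  · exact fst_ne_zeroVar_of_mem_slotAssigns hi hp h

theorem wellFormed_prog (J : ℕ) (rules : List ((A × A) × (A × A))) (u : ℕ → A) (a : A) :
    (prog J rules u a).WellFormed := by
  refine ⟨wellFormed_seqList_assigns _, ⟨not_assigns_body J rules, ?_⟩,
    wellFormed_seqList_assigns _⟩
  refine wellFormed_chooseList _ fun c hc => ?_
  obtain ⟨i, hi, r, -, rfl⟩ : ∃ i < J, ∃ r ∈ rules, seqList (assigns (ruleAssigns J i r)) = c := by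
    simpa using hc
  exact wellFormed_seqList_assigns _

theorem loopCount_prog (J : ℕ) (rules : List ((A × A) × (A × A))) (u : ℕ → A) (a : A) :
    (prog J rules u a).loopCount = 1 := by
  have h : (body J rules).loopCount = 0 := by
    refine loopCount_chooseList _ fun c hc => ?_
    obtain ⟨i, hi, r, -, rfl⟩ :
        ∃ i < J, ∃ r ∈ rules, seqList (assigns (ruleAssigns J i r)) = c := by
      simpa using hc
    exact loopCount_seqList_assigns _
  simp [prog, Cmd.loopCount, h, loopCount_seqList_assigns]

/-- The instance of DEG that asks whether the word `u` can be rewritten to a power of `a`. -/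
noncomputable def toInstance (J : ℕ) (rules : List ((A × A) × (A × A))) (u : ℕ → A) (a : A) :
    Instance where
  n := numVars A J
  prog := prog J rules u a
  wellFormed := wellFormed_prog J rules u a
  j := resVar A J
  d := 4 * J + 1

theorem runAssigns_reset {n : ℕ} (z : Fin n) (l : List (Fin n)) (hz : z ∉ l) (y : State n)
    (k : Fin n) :
    runAssigns (l.map fun t => (t, .var z)) y k = if k ∈ l then y z else y k := by
  induction l generalizing y with
  | nil => simp [runAssigns]
  | cons t l ih =>
    simp only [List.mem_cons, not_or] at hz
    rw [List.map_cons, runAssigns_cons, ih hz.2]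
    by_cases hk : k ∈ l
    · simp [hk, Function.update_of_ne hz.1]
    · by_cases hkt : k = t
      · subst hkt
        simp [hk, Expr.eval]
      · simp [hk, hkt]

theorem sem_body (J : ℕ) (rules : List ((A × A) × (A × A))) (y y' : State (numVars A J)) :
    (body J rules).sem y y' ↔
      (∃ i < J, ∃ r ∈ rules, y' = runAssigns (ruleAssigns J i r) y) ∨ y' = y := by
  rw [body, sem_chooseList]
  simp only [List.mem_flatMap, List.mem_range, List.mem_map]
  refine or_congr_left ⟨?_, ?_⟩
  · rintro ⟨c, ⟨i, hi, r, hr, rfl⟩, hc⟩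
    exact ⟨i, hi, r, hr, (sem_assigns _ _ _).1 hc⟩
  · rintro ⟨i, hi, r, hr, h⟩
    exact ⟨_, ⟨i, hi, r, hr, rfl⟩, (sem_assigns _ _ _).2 h⟩

theorem sem_prog (J : ℕ) (rules : List ((A × A) × (A × A))) (u : ℕ → A) (a : A)
    (y y' : State (numVars A J)) :
    (prog J rules u a).sem y y' ↔ ∃ z,
      (∃ m ≤ runAssigns (initAssigns J u) y (zeroVar A J),
        relPow (body J rules).sem m (runAssigns (initAssigns J u) y) z) ∧
      y' = runAssigns (finalAssigns J a) z := by
  simp only [prog, Cmd.sem, sem_assigns, exists_eq_left]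

variable [DecidableEq A]

/-- The effect of a replacement of `u` by `v` at position `i` on a partial word: if `u` is not
there, the position is left without a letter. -/
def slotStep (W : ℕ → Option A) (i : ℕ) (u v : A) : ℕ → Option A :=
  Function.update W i (if W i = some u then some v else none)

/-- The application of a rule at a pair of neighbouring positions of a partial word, whether or
not the left-hand side of the rule is there. -/
def PStep (J : ℕ) (rules : List ((A × A) × (A × A))) (W W' : ℕ → Option A) : Prop :=
  ∃ i < J, ∃ r ∈ rules, W' = slotStep (slotStep W i r.1.1 r.2.1) (i + 1) r.1.2 r.2.2

/-- The state `y` represents the partial word `W` at the positions `0, …, J`. -/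
def Rep (J x : ℕ) (W : ℕ → Option A) (y : State (numVars A J)) : Prop :=
  y (zeroVar A J) = x ∧ ∀ i ≤ J, ∀ b, y (cellVar J i b) = if W i = some b then x * x else x

/-- The assignments for one position simulate `slotStep` whether or not the letter `u` is there. -/
theorem Rep.slot {J x i : ℕ} {W : ℕ → Option A} {y : State (numVars A J)} (h : Rep J x W y)
    (hi : i ≤ J) (u v : A) :
    Rep J x (slotStep W i u v) (runAssigns (slotAssigns J i u v) y) := by
  obtain ⟨h0, hc⟩ := h
  set l := (Finset.univ : Finset A).toList.map (fun b => cellVar J i b) with hl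
  have hmem : ∀ k, k ∈ l ↔ ∃ b, cellVar J i b = k := by simp [hl]
  have hz : zeroVar A J ∉ l := by
    rw [hmem]
    rintro ⟨b, hb⟩
    exact cellVar_ne_zeroVar hi b hb
  have hr : resVar A J ∉ l := by
    rw [hmem]
    rintro ⟨b, hb⟩
    exact cellVar_ne_resVar hi b hb
  have hrun : runAssigns (slotAssigns J i u v) y = fun k =>
      if k = cellVar J i v then y (cellVar J i u) else if k ∈ l then x else
        if k = resVar A J then y (cellVar J i u) else y k := by
    have hm : (Finset.univ : Finset A).toList.map
        (fun b => ((cellVar J i b, .var (zeroVar A J)) : _ × Expr (numVars A J))) =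
          l.map fun t => (t, .var (zeroVar A J)) := by
      simp [hl, Function.comp_def]
    rw [slotAssigns, runAssigns_cons, runAssigns_append, hm]
    funext k
    simp only [runAssigns_cons, Expr.eval]
    simp only [runAssigns, List.foldl_nil]
    by_cases hk : k = cellVar J i v
    · subst hk
      have := runAssigns_reset (zeroVar A J) l hz
        (Function.update y (resVar A J) (y (cellVar J i u))) (resVar A J)
      simpa [hr, runAssigns] using this
    · have := runAssigns_reset (zeroVar A J) l hz
        (Function.update y (resVar A J) (y (cellVar J i u))) k
      rw [Function.update_of_ne (resVar_ne_zeroVar J).symm, h0] at this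
      simp only [hk, if_false, ne_eq, not_false_eq_true, Function.update_of_ne]
      simpa [runAssigns, Function.update_apply] using this
  rw [hrun]
  constructor
  · simp [(cellVar_ne_zeroVar hi v).symm, hz, (resVar_ne_zeroVar J).symm, h0]
  · intro i' hi' b
    have hmem' : cellVar J i' b ∈ l ↔ i = i' := by
      rw [hmem]
      refine ⟨fun ⟨b', hb'⟩ => ((cellVar_inj hi hi').1 hb').1, fun h => ⟨b, by rw [h]⟩⟩
    simp only [cellVar_inj hi' hi, hmem', cellVar_ne_resVar hi', if_false, hc i hi, hc i' hi']
    by_cases hii : i' = i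
    · subst hii
      by_cases hb : b = v
      · subst hb
        by_cases hW : W i' = some u <;> simp [slotStep, hW]
      · by_cases hW : W i' = some u <;> simp [slotStep, hW, hb, Ne.symm hb]
    · simp [hii, Ne.symm hii, slotStep]

/-- The program cannot tell whether a rule is applicable, but it does not need to: an arbitrary
application of a rule is matched by a step on partial words. -/
theorem Rep.rule {J x i : ℕ} {W : ℕ → Option A} {y : State (numVars A J)} (h : Rep J x W y)
    (hi : i < J) (r : (A × A) × (A × A)) :
    Rep J x (slotStep (slotStep W i r.1.1 r.2.1) (i + 1) r.1.2 r.2.2)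
      (runAssigns (ruleAssigns J i r) y) := by
  rw [ruleAssigns, runAssigns_append]
  exact (h.slot hi.le _ _).slot hi _ _

theorem Rep.of_relPow {J x m : ℕ} {rules : List ((A × A) × (A × A))} {W : ℕ → Option A}
    {y y' : State (numVars A J)} (h : Rep J x W y) (hy : relPow (body J rules).sem m y y') :
    ∃ W', ReflTransGen (PStep J rules) W W' ∧ Rep J x W' y' := by
  induction m generalizing y' with
  | zero =>
    obtain rfl : y = y' := hy
    exact ⟨W, .refl, h⟩
  | succ m ih =>
    obtain ⟨z, hz, hy⟩ := hy
    obtain ⟨W', hW', hr⟩ := ih hz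
    rcases (sem_body J rules z y').1 hy with ⟨i, hi, r, hr', rfl⟩ | rfl
    · exact ⟨_, hW'.tail ⟨i, hi, r, hr', rfl⟩, hr.rule hi r⟩
    · exact ⟨W', hW', hr⟩

/-- The number of iterations that simulate a given rewriting does not depend on the input. -/
theorem exists_relPow {J : ℕ} {rules : List ((A × A) × (A × A))} {W W' : ℕ → Option A}
    (hW : ReflTransGen (PStep J rules) W W') :
    ∃ m, ∀ x y, Rep J x W y → ∃ y', relPow (body J rules).sem m y y' ∧ Rep J x W' y' := by
  induction hW with
  | refl => exact ⟨0, fun x y h => ⟨y, rfl, h⟩⟩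
  | tail _ hs ih =>
    obtain ⟨m, hm⟩ := ih
    obtain ⟨i, hi, r, hr, rfl⟩ := hs
    refine ⟨m + 1, fun x y h => ?_⟩
    obtain ⟨z, hz, hrep⟩ := hm x y h
    exact ⟨_, ⟨z, hz, (sem_body J rules _ _).2 (Or.inl ⟨i, hi, r, hr, rfl⟩)⟩, hrep.rule hi r⟩

theorem rep_init (J x : ℕ) (u : ℕ → A) :
    Rep J x (fun i => some (u i)) (runAssigns (initAssigns J u) fun _ => x) := by
  have key : ∀ k ≤ J + 1, ∀ y : State (numVars A J),
      y = runAssigns ((List.range k).map fun i =>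
        (cellVar J i (u i), .mul (zeroVar A J) (zeroVar A J))) (fun _ => x) →
      y (zeroVar A J) = x ∧ ∀ i ≤ J, ∀ b,
        y (cellVar J i b) = if i < k ∧ u i = b then x * x else x := by
    intro k
    induction k with
    | zero =>
      rintro - y rfl
      simp [runAssigns]
    | succ k ih =>
      rintro hk y rfl
      obtain ⟨h0, hc⟩ := ih (by omega) _ rfl
      have hk : k ≤ J := by omega
      rw [List.range_succ, List.map_append, runAssigns_append, List.map_singleton,
        runAssigns_cons]
      simp only [Expr.eval, h0]
      rw [runAssigns, List.foldl_nil]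
      constructor
      · rw [Function.update_of_ne (cellVar_ne_zeroVar hk _).symm, h0]
      · intro i hi b
        rw [Function.update_apply, hc i hi b]
        simp only [cellVar_inj hi hk]
        by_cases hik : i = k
        · subst hik
          by_cases hb : b = u i
          · simp [hb]
          · simp [hb, Ne.symm hb]
        · have : i < k + 1 ↔ i < k := by omega
          simp [hik, this]
  obtain ⟨h0, hc⟩ := key (J + 1) le_rfl _ rfl
  refine ⟨h0, fun i hi b => ?_⟩
  rw [initAssigns, hc i hi b]
  simp [Nat.lt_succ_of_le hi]

/-- The degree of the variable for the letter `a` at position `i`. -/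
def cellDegree (W : ℕ → Option A) (a : A) (i : ℕ) : ℕ := if W i = some a then 2 else 1

/-- Each variable is a power of the input, so the final product adds up the degrees. -/
theorem Rep.final {J x : ℕ} {W : ℕ → Option A} {y : State (numVars A J)} (h : Rep J x W y)
    (a : A) :
    runAssigns (finalAssigns J a) y (resVar A J) =
      x ^ (∑ i ∈ Finset.range J, (cellDegree W a i + cellDegree W a (i + 1)) + 1) := by
  obtain ⟨h0, hc⟩ := h
  have hc : ∀ i ≤ J, y (cellVar J i a) = x ^ cellDegree W a i := by
    intro i hi
    rw [hc i hi, cellDegree]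
    split_ifs <;> ring
  rw [finalAssigns, runAssigns_cons]
  simp only [Expr.eval, h0]
  have key : ∀ k ≤ J,
      runAssigns ((List.range k).flatMap fun i =>
        [(resVar A J, .mul (resVar A J) (cellVar J i a)),
          (resVar A J, .mul (resVar A J) (cellVar J (i + 1) a))])
        (Function.update y (resVar A J) x) = Function.update y (resVar A J)
          (x ^ (∑ i ∈ Finset.range k, (cellDegree W a i + cellDegree W a (i + 1)) + 1)) := by
    intro k
    induction k with
    | zero =>
      intro _
      simp [runAssigns]
    | succ k ih =>
      intro hk
      rw [List.range_succ, List.flatMap_append, runAssigns_append, ih (by omega)]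
      simp only [List.flatMap_singleton, runAssigns_cons, Expr.eval, Function.update_self,
        Function.update_idem, Function.update_of_ne (cellVar_ne_resVar (show k ≤ J by omega) a),
        Function.update_of_ne (cellVar_ne_resVar hk a), hc k (by omega), hc (k + 1) hk]
      rw [runAssigns, List.foldl_nil, Finset.sum_range_succ]
      congr 1
      ring
  rw [key J le_rfl, Function.update_self]

theorem le_maxFinalValue {J : ℕ} {rules : List ((A × A) × (A × A))} {u : ℕ → A} {a : A}
    {W : ℕ → Option A} (hW : ReflTransGen (PStep J rules) (fun i => some (u i)) W)
    (ha : ∀ i ≤ J, W i = some a) :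
    ∃ k, ∀ x ≥ k, x ^ (4 * J + 1) ≤ maxFinalValue (prog J rules u a) (resVar A J) x := by
  obtain ⟨m, hm⟩ := exists_relPow hW
  refine ⟨m, fun x hx => ?_⟩
  obtain ⟨z, hz, hrep⟩ := hm x _ (rep_init J x u)
  refine (isGreatest_maxFinalValue _ _ x).2 ⟨runAssigns (finalAssigns J a) z,
    (sem_prog J rules u a _ _).2 ⟨z, ⟨m, ?_, hz⟩, rfl⟩, ?_⟩
  · rw [(rep_init J x u).1]
    exact hx
  · rw [hrep.final a]
    congr 2
    have : ∀ i ∈ Finset.range J, cellDegree W a i + cellDegree W a (i + 1) = 4 := by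
      intro i hi
      rw [Finset.mem_range] at hi
      simp [cellDegree, ha i hi.le, ha (i + 1) hi]
    rw [Finset.sum_congr rfl this]
    simp [Nat.mul_comm]

theorem maxFinalValue_le {J : ℕ} (hJ : 0 < J) {rules : List ((A × A) × (A × A))} {u : ℕ → A} {a : A}
    (h : ∀ W, ReflTransGen (PStep J rules) (fun i => some (u i)) W → ∃ i ≤ J, W i ≠ some a)
    {x : ℕ} (hx : 0 < x) :
    maxFinalValue (prog J rules u a) (resVar A J) x ≤ x ^ (4 * J) := by
  obtain ⟨y, hy, hv⟩ := (isGreatest_maxFinalValue (prog J rules u a) (resVar A J) x).1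
  obtain ⟨z, ⟨m, -, hz⟩, rfl⟩ := (sem_prog J rules u a _ _).1 hy
  obtain ⟨W, hW, hrep⟩ := (rep_init J x u).of_relPow hz
  rw [hv, hrep.final a]
  refine Nat.pow_le_pow_right hx ?_
  obtain ⟨i, hi, hWi⟩ := h W hW
  have h2 : ∀ i, cellDegree W a i ≤ 2 := by
    intro i
    rw [cellDegree]
    split_ifs <;> simp
  have h1 : cellDegree W a i = 1 := by simp [cellDegree, hWi]
  have : ∑ i ∈ Finset.range J, (cellDegree W a i + cellDegree W a (i + 1)) <
      ∑ i ∈ Finset.range J, 4 := by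
    refine Finset.sum_lt_sum (fun i _ => by linarith [h2 i, h2 (i + 1)]) ?_
    rcases hi.lt_or_eq with hi | rfl
    · exact ⟨i, Finset.mem_range.2 hi, by linarith [h2 (i + 1)]⟩
    · -- the last position occurs only as the right-hand element of a pair
      obtain ⟨i, rfl⟩ := Nat.exists_eq_add_one_of_ne_zero hJ.ne'
      exact ⟨i, Finset.mem_range.2 (Nat.lt_succ_self i), by linarith [h2 i]⟩
  simp only [Finset.sum_const, Finset.card_range, smul_eq_mul] at this
  linarith

theorem toInstance_mem_DEG_iff {J : ℕ} (hJ : 0 < J) (rules : List ((A × A) × (A × A)))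
    (u : ℕ → A) (a : A) :
    toInstance J rules u a ∈ DEG ↔
      ∃ W, ReflTransGen (PStep J rules) (fun i => some (u i)) W ∧ ∀ i ≤ J, W i = some a := by
  change (fun x : ℕ => (x : ℝ) ^ (4 * J + 1)) =O[Filter.atTop]
    (fun x : ℕ => (maxFinalValue (prog J rules u a) (resVar A J) x : ℝ)) ↔ _
  constructor
  · intro hO
    by_contra! hcon
    obtain ⟨C, hC⟩ := hO.bound
    obtain ⟨N, hN⟩ := Filter.eventually_atTop.1 hC
    obtain ⟨M, hM⟩ := exists_nat_gt C
    set x := max (max N M) 1 with hxdef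
    have hx1 : 0 < x := lt_of_lt_of_le one_pos (le_max_right _ _)
    have hxN : N ≤ x := (le_max_left _ _).trans (le_max_left _ _)
    have hxM : M ≤ x := (le_max_right N M).trans (le_max_left _ _)
    have hb := hN x hxN
    have hle : (maxFinalValue (prog J rules u a) (resVar A J) x : ℝ) ≤ (x : ℝ) ^ (4 * J) := by
      exact_mod_cast maxFinalValue_le hJ hcon hx1
    have hxpos : (0 : ℝ) < (x : ℝ) := by exact_mod_cast hx1
    have hCx : C < x := hM.trans_le (by exact_mod_cast hxM)
    rw [Real.norm_of_nonneg (by positivity), Real.norm_of_nonneg (by positivity)] at hb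
    have hpow : (0 : ℝ) < (x : ℝ) ^ (4 * J) := by positivity
    have : (x : ℝ) ^ (4 * J + 1) ≤ max C 0 * (x : ℝ) ^ (4 * J) :=
      hb.trans ((mul_le_mul_of_nonneg_right (le_max_left C 0) (by positivity)).trans
        (mul_le_mul_of_nonneg_left hle (le_max_right _ _)))
    rw [pow_succ, mul_comm] at this
    have := le_of_mul_le_mul_right this hpow
    exact absurd this (not_le.2 (max_lt hCx hxpos))
  · rintro ⟨W, hW, ha⟩
    obtain ⟨k, hk⟩ := le_maxFinalValue hW ha
    refine Asymptotics.IsBigO.of_bound 1 (Filter.eventually_atTop.2 ⟨k, fun x hx => ?_⟩)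
    rw [Real.norm_of_nonneg (by positivity), Real.norm_of_nonneg (by positivity), one_mul]
    exact_mod_cast hk x hx

end

end Rewriting

end CoreLang

/-! ### Simulation of space-bounded machines by rewriting -/

namespace SpaceBounded

open Turing Relation CoreLang.Rewriting

/-- The letters of the words that represent configurations of `D`: a tape symbol together with the
state if the head is on that cell, a marker for the cell to the left of the input before the
computation starts, and a marker for successful termination. -/
inductive Letter {α : Type} (D : Decider α) : Type
  | cell (a : D.Γ) (q : Option D.Q) : Letter D
  | start : Letter D
  | done : Letter D

namespace Decider

variable {α : Type} (D : Decider α)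

instance : Finite (Letter D) := by
  let f : Letter D → (D.Γ × Option D.Q) ⊕ Bool := fun l => match l with
    | .cell a q => .inl (a, q)
    | .start => .inr false
    | .done => .inr true
  refine Finite.of_injective f ?_
  rintro (⟨a, q⟩ | _ | _) (⟨a', q'⟩ | _ | _) h <;> simp_all [f]

noncomputable instance : Fintype (Letter D) := Fintype.ofFinite _

noncomputable instance : DecidableEq (Letter D) := Classical.decEq _

/-- The rewriting rules that simulate `D`.  When an accepting halting configuration is reached, the
marker of successful termination appears and spreads over the whole word. -/
inductive IsRule : (Letter D × Letter D) × (Letter D × Letter D) → Prop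
  | start (a : D.Γ) :
      IsRule ((.start, .cell a none), (.cell default none, .cell a (some default)))
  | write {q q' : D.Q} {a b : D.Γ} (u : Letter D) (h : D.machine q a = some (q', .write b)) :
      IsRule ((.cell a (some q), u), (.cell b (some q'), u))
  | right {q q' : D.Q} {a : D.Γ} (b : D.Γ) (h : D.machine q a = some (q', .move .right)) :
      IsRule ((.cell a (some q), .cell b none), (.cell a none, .cell b (some q')))
  | left {q q' : D.Q} {a : D.Γ} (b : D.Γ) (h : D.machine q a = some (q', .move .left)) :
      IsRule ((.cell b none, .cell a (some q)), (.cell b (some q'), .cell a none))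
  | accept {q : D.Q} {a : D.Γ} (u : Letter D) (h : D.machine q a = none) (hq : q ∈ D.accept) :
      IsRule ((.cell a (some q), u), (.done, .done))
  | spreadRight (u : Letter D) : IsRule ((.done, u), (.done, .done))
  | spreadLeft (u : Letter D) : IsRule ((u, .done), (.done, .done))

open Classical in
/-- The list of all rules. -/
noncomputable def rules : List ((Letter D × Letter D) × (Letter D × Letter D)) :=
  (Finset.univ.filter D.IsRule).toList

theorem mem_rules {r : (Letter D × Letter D) × (Letter D × Letter D)} :
    r ∈ D.rules ↔ D.IsRule r := by
  simp [rules]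

/-- The letter of a tape cell without the head. -/
def plain (a : D.Γ) : Letter D := .cell a none

/-- The initial word: `s` blanks, the start marker, the input, and blanks. -/
def startWord (s : ℕ) (w : List α) (i : ℕ) : Letter D :=
  if i < s then D.plain default
  else if i = s then .start
  else D.plain ((w.map D.inputSym).getI (i - (s + 1)))

/-- The word that represents the configuration `c` with the head on the cell number `z`; the cell
number `0` has the position `s + 1`. -/
def cfgWord (s : ℕ) (c : TM0.Cfg D.Γ D.Q) (z : ℤ) (i : ℕ) : Option (Letter D) :=
  some (.cell (c.Tape.nth ((i : ℤ) - (s + 1) - z))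
    (if (i : ℤ) - (s + 1) = z then some c.q else none))

variable {D}

theorem init_nth (w : List α) (z : ℤ) :
    (D.init w).Tape.nth z = if z < 0 then default else (w.map D.inputSym).getI z.toNat := by
  rcases z with n | n
  · simp [Decider.init, TM0.init, Tape.mk₁, Tape.mk₂, Tape.mk'_nth_nat, ListBlank.nth_mk]
  · rw [if_pos (Int.negSucc_lt_zero n)]
    change (ListBlank.mk ([] : List D.Γ)).nth n = default
    rw [ListBlank.nth_mk]
    rfl

theorem cfgWord_init (s : ℕ) (w : List α) :
    Function.update (Function.update (fun i => some (D.startWord s w i)) s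
        (some (.cell default none))) (s + 1)
        (some (.cell ((w.map D.inputSym).getI 0) (some default))) =
      D.cfgWord s (D.init w) 0 := by
  funext i
  by_cases h1 : i = s + 1
  · subst h1
    have : ((s + 1 : ℕ) : ℤ) - (s + 1) = 0 := by push_cast; ring
    rw [Function.update_self, cfgWord, this, sub_zero, if_pos rfl, init_nth]
    rfl
  · rw [Function.update_of_ne h1, cfgWord, sub_zero, init_nth,
      if_neg (show ¬ ((i : ℤ) - (s + 1) = 0) by omega)]
    by_cases h2 : i = s
    · subst h2
      rw [Function.update_self, if_pos (by omega)]
    · rw [Function.update_of_ne h2, startWord, plain, plain]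
      by_cases h3 : i < s
      · rw [if_pos h3, if_pos (by omega)]
      · rw [if_neg h3, if_neg h2, if_neg (by omega)]
        have : ((i : ℤ) - (s + 1)).toNat = i - (s + 1) := by omega
        rw [this]

theorem cfgWord_write {s h : ℕ} {c : TM0.Cfg D.Γ D.Q} {z : ℤ} (hh : (h : ℤ) - (s + 1) = z)
    (q' : D.Q) (b : D.Γ) :
    Function.update (Function.update (D.cfgWord s c z) h (some (.cell b (some q')))) (h + 1)
        (D.cfgWord s c z (h + 1)) = D.cfgWord s ⟨q', c.Tape.write b⟩ z := by
  funext i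
  have hw : ∀ i : ℕ, i ≠ h → D.cfgWord s ⟨q', c.Tape.write b⟩ z i = D.cfgWord s c z i := by
    intro i hi
    rw [cfgWord, cfgWord, Tape.write_nth, if_neg (by omega), if_neg (by omega), if_neg (by omega)]
  by_cases h1 : i = h + 1
  · subst h1
    rw [Function.update_self, hw _ (by omega)]
  · rw [Function.update_of_ne h1]
    by_cases h2 : i = h
    · subst h2
      rw [Function.update_self, cfgWord, Tape.write_nth, if_pos (by omega), if_pos hh]
    · rw [Function.update_of_ne h2, hw _ h2]

theorem cfgWord_right {s h : ℕ} {c : TM0.Cfg D.Γ D.Q} {z : ℤ} (hh : (h : ℤ) - (s + 1) = z)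
    (q' : D.Q) :
    Function.update (Function.update (D.cfgWord s c z) h (some (.cell c.Tape.head none))) (h + 1)
        (some (.cell (c.Tape.nth 1) (some q'))) =
      D.cfgWord s ⟨q', c.Tape.move .right⟩ (z + 1) := by
  funext i
  rw [cfgWord, Tape.move_right_nth]
  by_cases h1 : i = h + 1
  · subst h1
    have : ((h + 1 : ℕ) : ℤ) - (s + 1) - (z + 1) + 1 = 1 := by push_cast; omega
    rw [Function.update_self, this, if_pos (by push_cast; omega)]
  · rw [Function.update_of_ne h1, if_neg (by omega)]
    by_cases h2 : i = h
    · subst h2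
      have : (i : ℤ) - (s + 1) - (z + 1) + 1 = 0 := by omega
      rw [Function.update_self, this, Tape.nth_zero]
    · have : (i : ℤ) - (s + 1) - (z + 1) + 1 = (i : ℤ) - (s + 1) - z := by omega
      rw [Function.update_of_ne h2, this, cfgWord, if_neg (by omega)]

theorem cfgWord_left {s h : ℕ} {c : TM0.Cfg D.Γ D.Q} {z : ℤ} (hh : ((h + 1 : ℕ) : ℤ) - (s + 1) = z)
    (q' : D.Q) :
    Function.update (Function.update (D.cfgWord s c z) h
        (some (.cell (c.Tape.nth (-1)) (some q')))) (h + 1)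
        (some (.cell c.Tape.head none)) =
      D.cfgWord s ⟨q', c.Tape.move .left⟩ (z + -1) := by
  funext i
  push_cast at hh
  rw [cfgWord, Tape.move_left_nth]
  by_cases h1 : i = h + 1
  · subst h1
    have : ((h + 1 : ℕ) : ℤ) - (s + 1) - (z + -1) - 1 = 0 := by push_cast; omega
    rw [Function.update_self, this, Tape.nth_zero, if_neg (by push_cast; omega)]
  · rw [Function.update_of_ne h1]
    by_cases h2 : i = h
    · subst h2
      have : (i : ℤ) - (s + 1) - (z + -1) - 1 = -1 := by omega
      rw [Function.update_self, this, if_pos (by omega)]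
    · have : (i : ℤ) - (s + 1) - (z + -1) - 1 = (i : ℤ) - (s + 1) - z := by omega
      rw [Function.update_of_ne h2, this, cfgWord, if_neg (by omega), if_neg (by omega)]

theorem cfgWord_head {s h : ℕ} {c : TM0.Cfg D.Γ D.Q} {z : ℤ} (hh : (h : ℤ) - (s + 1) = z) :
    D.cfgWord s c z h = some (.cell c.Tape.head (some c.q)) := by
  rw [cfgWord, if_pos hh, hh, sub_self, Tape.nth_zero]

theorem cfgWord_head_iff {s i : ℕ} {c : TM0.Cfg D.Γ D.Q} {z : ℤ} {a : D.Γ} {q : D.Q} :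
    D.cfgWord s c z i = some (.cell a (some q)) ↔
      (i : ℤ) - (s + 1) = z ∧ a = c.Tape.head ∧ q = c.q := by
  constructor
  · intro h
    have hi : (i : ℤ) - (s + 1) = z := by
      by_contra hne
      rw [cfgWord, if_neg hne] at h
      simp at h
    rw [cfgWord_head hi] at h
    simp only [Option.some.injEq, Letter.cell.injEq] at h
    exact ⟨hi, h.1.symm, h.2.symm⟩
  · rintro ⟨hi, rfl, rfl⟩
    exact cfgWord_head hi

theorem slotStep_slotStep {A : Type} [DecidableEq A] {W : ℕ → Option A} {i : ℕ} {u u' v v' : A}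
    (h : W i = some u) (h' : W (i + 1) = some u') :
    slotStep (slotStep W i u v) (i + 1) u' v' =
      Function.update (Function.update W i (some v)) (i + 1) (some v') := by
  simp [slotStep, h, h']

theorem pstep_of_rule {J : ℕ} {W : ℕ → Option (Letter D)} {i : ℕ} {u u' v v' : Letter D}
    (hi : i < J) (hr : D.IsRule ((u, u'), (v, v'))) (h : W i = some u) (h' : W (i + 1) = some u') :
    PStep J D.rules W (Function.update (Function.update W i (some v)) (i + 1) (some v')) :=
  ⟨i, hi, _, D.mem_rules.2 hr, (slotStep_slotStep h h').symm⟩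

/-- The tape after an action of the machine. -/
def applyStmt {Γ : Type} [Inhabited Γ] (T : Tape Γ) : TM0.Stmt Γ → Tape Γ
  | .move d => T.move d
  | .write b => T.write b

theorem step_of_machine {c : TM0.Cfg D.Γ D.Q} {q' : D.Q} {a : TM0.Stmt D.Γ}
    (h : D.machine c.q c.Tape.head = some (q', a)) :
    TM0.step D.machine c = some ⟨q', applyStmt c.Tape a⟩ := by
  have : TM0.step D.machine c = (D.machine c.q c.Tape.head).map fun p =>
      ⟨p.1, applyStmt c.Tape p.2⟩ := by
    obtain ⟨q, T⟩ := c
    refine congrArg (fun f => Option.map f (D.machine q T.head)) (funext fun p => ?_)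
    rcases p with ⟨q', d | b⟩ <;> rfl
  rw [this, h, Option.map_some]

theorem Trace.reaches {w : List α} {c : TM0.Cfg D.Γ D.Q} {z : ℤ} (h : D.Trace w c z) :
    TM0.Reaches D.machine (D.init w) c := by
  induction h with
  | start => exact ReflTransGen.refl
  | next _ _ hs ih => exact ReflTransGen.tail ih hs

theorem exists_trace {w : List α} {c : TM0.Cfg D.Γ D.Q}
    (h : TM0.Reaches D.machine (D.init w) c) : ∃ z, D.Trace w c z := by
  induction h with
  | refl => exact ⟨0, .start⟩
  | @tail c c' _ hs ih =>
    obtain ⟨z, hz⟩ := ih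
    obtain ⟨⟨q', a⟩, hm, -⟩ := Option.map_eq_some_iff.1 (show Option.map _ _ = some c' from hs)
    exact ⟨_, hz.next hm hs⟩

theorem step_eq_none_iff {c : TM0.Cfg D.Γ D.Q} :
    TM0.step D.machine c = none ↔ D.machine c.q c.Tape.head = none := by
  obtain ⟨q, T⟩ := c
  exact Option.map_eq_none_iff

section

variable {s J : ℕ} {w : List α}

theorem pstep_start (hJ : s < J) :
    PStep J D.rules (fun i => some (D.startWord s w i)) (D.cfgWord s (D.init w) 0) := by
  rw [← cfgWord_init]
  refine pstep_of_rule hJ (.start _) ?_ ?_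
  · simp [startWord]
  · simp [startWord, plain]

/-- The bound `|z| + 2 ≤ s` keeps the head and its neighbours inside the word. -/
theorem reaches_of_trace (hs : ∀ c z, D.Trace w c z → |z| + 2 ≤ (s : ℤ)) (hJ : 2 * s ≤ J)
    {c : TM0.Cfg D.Γ D.Q} {z : ℤ} (h : D.Trace w c z) :
    ReflTransGen (PStep J D.rules) (fun i => some (D.startWord s w i)) (D.cfgWord s c z) := by
  induction h with
  | start =>
    have := hs _ _ Trace.start
    rw [abs_zero] at this
    exact .single (pstep_start (by omega))
  | @next c c' z q' a hc hm hstep ih =>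
    refine ih.tail ?_
    have hz := hs _ _ hc
    have hz₁ := le_abs_self z
    have hz₂ := neg_abs_le z
    rw [step_of_machine hm] at hstep
    obtain rfl := Option.some.inj hstep
    obtain ⟨h, hh⟩ : ∃ h : ℕ, (h : ℤ) - (s + 1) = z := ⟨(z + (s + 1)).toNat, by omega⟩
    match a with
    | .write b =>
      simp only [shift, add_zero, applyStmt]
      rw [← cfgWord_write hh q' b]
      exact pstep_of_rule (by omega) (.write _ hm) (cfgWord_head hh) rfl
    | .move .right =>
      simp only [shift, applyStmt]
      rw [← cfgWord_right hh q']
      refine pstep_of_rule (by omega) (.right _ hm) (cfgWord_head hh) ?_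
      rw [cfgWord, if_neg (by push_cast; omega)]
      have : ((h + 1 : ℕ) : ℤ) - (s + 1) - z = 1 := by push_cast; omega
      rw [this]
    | .move .left =>
      simp only [shift, applyStmt]
      obtain ⟨h, rfl⟩ := Nat.exists_eq_add_one_of_ne_zero (show h ≠ 0 by omega)
      rw [← cfgWord_left hh q']
      refine pstep_of_rule (by omega) (.left _ hm) ?_ (cfgWord_head hh)
      rw [cfgWord, if_neg (by push_cast at hh; omega)]
      have : (h : ℤ) - (s + 1) - z = -1 := by push_cast at hh; omega
      rw [this]

/-- The word `W` with the marker of successful termination at the positions `a, …, b`. -/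
def fill (W : ℕ → Option (Letter D)) (a b i : ℕ) : Option (Letter D) :=
  if a ≤ i ∧ i ≤ b then some .done else W i

theorem reaches_fill_right {W : ℕ → Option (Letter D)} (hW : ∀ i, ∃ u, W i = some u) {h : ℕ}
    (hh : W h = some .done) (k : ℕ) (hk : h + k ≤ J) :
    ReflTransGen (PStep J D.rules) W (fill W h (h + k)) := by
  induction k with
  | zero =>
    have : fill W h (h + 0) = W := by
      funext i
      rw [fill]
      split_ifs with hi
      · rw [show i = h by omega, hh]
      · rfl
    rw [this]
  | succ k ih =>
    refine (ih (by omega)).tail ?_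
    obtain ⟨u, hu⟩ := hW (h + k + 1)
    have := pstep_of_rule (W := fill W h (h + k)) (J := J) (i := h + k) (by omega)
      (.spreadRight u) (by simp [fill]) (by simp [fill, hu])
    convert this using 1
    funext i
    by_cases h1 : i = h + k + 1
    · subst h1
      rw [Function.update_self, fill, if_pos (by omega)]
    · rw [Function.update_of_ne h1, fill]
      by_cases h2 : i = h + k
      · subst h2
        rw [Function.update_self, if_pos (by omega)]
      · rw [Function.update_of_ne h2, fill]
        congr 1
        apply propext
        omega

theorem reaches_fill_left {W : ℕ → Option (Letter D)} (hW : ∀ i, ∃ u, W i = some u) {h : ℕ}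
    (hh : h ≤ J) : ReflTransGen (PStep J D.rules) (fill W h J) (fill W 0 J) := by
  induction h with
  | zero => exact .refl
  | succ h ih =>
    refine .head ?_ (ih (by omega))
    obtain ⟨u, hu⟩ := hW h
    have := pstep_of_rule (W := fill W (h + 1) J) (J := J) (i := h) (by omega)
      (.spreadLeft u) (by simp [fill, hu]) (by simp [fill, hh])
    convert this using 1
    funext i
    by_cases h1 : i = h + 1
    · subst h1
      rw [Function.update_self, fill, if_pos (by omega)]
    · rw [Function.update_of_ne h1, fill]
      by_cases h2 : i = h
      · subst h2
        rw [Function.update_self, if_pos (by omega)]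
      · rw [Function.update_of_ne h2, fill]
        congr 1
        apply propext
        omega

theorem reaches_done (hs : ∀ c z, D.Trace w c z → |z| + 2 ≤ (s : ℤ)) (hJ : 2 * s ≤ J)
    {c : TM0.Cfg D.Γ D.Q} {z : ℤ} (h : D.Trace w c z) (hc : TM0.step D.machine c = none)
    (hq : c.q ∈ D.accept) :
    ∃ W, ReflTransGen (PStep J D.rules) (fun i => some (D.startWord s w i)) W ∧
      ∀ i ≤ J, W i = some .done := by
  have hz := hs _ _ h
  have hz₁ := le_abs_self z
  have hz₂ := neg_abs_le z
  obtain ⟨k, hk⟩ : ∃ k : ℕ, (k : ℤ) - (s + 1) = z := ⟨(z + (s + 1)).toNat, by omega⟩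
  have h₁ := pstep_of_rule (D := D) (J := J) (W := D.cfgWord s c z) (show k < J by omega)
    (.accept _ (step_eq_none_iff.1 hc) hq) (cfgWord_head hk) rfl
  set W := Function.update (Function.update (D.cfgWord s c z) k (some .done)) (k + 1)
    (some Letter.done) with hWdef
  have hW : ∀ i, ∃ u, W i = some u := by
    intro i
    by_cases h1 : i = k + 1
    · exact ⟨.done, by rw [hWdef, h1, Function.update_self]⟩
    · by_cases h2 : i = k
      · exact ⟨.done, by rw [hWdef, Function.update_of_ne h1, h2, Function.update_self]⟩
      · exact ⟨_, by rw [hWdef, Function.update_of_ne h1, Function.update_of_ne h2, cfgWord]⟩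
  have hWk : W k = some .done := by
    rw [hWdef, Function.update_of_ne (by omega), Function.update_self]
  have h₂ := reaches_fill_right (J := J) hW hWk (J - k) (by omega)
  rw [show k + (J - k) = J by omega] at h₂
  have h₃ := reaches_fill_left (J := J) hW (show k ≤ J by omega)
  refine ⟨_, (((reaches_of_trace hs hJ h).tail h₁).trans h₂).trans h₃, fun i hi => ?_⟩
  simp [fill, hi]

/-- What can be reached from the initial word: a broken word, the initial word, a configuration of
the computation, or anything at all if the computation accepts. -/
def Reachable (D : Decider α) (L : Language α) (s J : ℕ) (w : List α) (W : ℕ → Option (Letter D)) :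
    Prop :=
  (∃ i ≤ J, W i = none) ∨ W = (fun i => some (D.startWord s w i)) ∨
    (∃ c z, D.Trace w c z ∧ W = D.cfgWord s c z) ∨ w ∈ L

theorem mem_of_trace {L : Language α} (hL : D.Decides L) {c : TM0.Cfg D.Γ D.Q} {z : ℤ}
    (h : D.Trace w c z) (hc : TM0.step D.machine c = none) : w ∈ L ↔ c.q ∈ D.accept := by
  obtain ⟨c', hr, hc', hw⟩ := hL w
  have h₁ : c ∈ StateTransition.eval (TM0.step D.machine) (D.init w) :=
    StateTransition.mem_eval.2 ⟨h.reaches, hc⟩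
  have h₂ : c' ∈ StateTransition.eval (TM0.step D.machine) (D.init w) :=
    StateTransition.mem_eval.2 ⟨hr, hc'⟩
  rw [Part.mem_unique h₁ h₂]
  exact hw

/-- Rewriting is as deterministic as the machine: a rule that is applied where its left-hand side
is missing breaks the word, and otherwise it performs the next step of the computation. -/
theorem Reachable.pstep {L : Language α} (hL : D.Decides L) {W W' : ℕ → Option (Letter D)}
    (h : Reachable D L s J w W) (hstep : PStep J D.rules W W') : Reachable D L s J w W' := by
  obtain ⟨i, hi, ⟨⟨u, u'⟩, ⟨v, v'⟩⟩, hr, rfl⟩ := hstep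
  rw [mem_rules] at hr
  by_cases hu : W i = some u
  swap
  · exact Or.inl ⟨i, hi.le, by simp [slotStep, hu]⟩
  by_cases hu' : W (i + 1) = some u'
  swap
  · exact Or.inl ⟨i + 1, hi, by simp [slotStep, hu']⟩
  simp only
  rw [slotStep_slotStep hu hu']
  rcases h with ⟨k, hk, hWk⟩ | rfl | ⟨c, z, hc, rfl⟩ | hw
  · refine Or.inl ⟨k, hk, ?_⟩
    rw [Function.update_of_ne, Function.update_of_ne, hWk]
    · rintro rfl
      simp [hWk] at hu
    · rintro rfl
      simp [hWk] at hu'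
  · -- the only rule whose left-hand side occurs in the initial word is the start rule
    have hno : ∀ k, D.startWord s w k = .start → k = s := by
      intro k hk
      by_contra hne
      rw [startWord, if_neg hne] at hk
      split_ifs at hk <;> simp [plain] at hk
    have hcell : ∀ k a q, D.startWord s w k ≠ .cell a (some q) := by
      intro k a q
      rw [startWord]
      split_ifs <;> simp [plain]
    have hdone : ∀ k, D.startWord s w k ≠ .done := by
      intro k
      rw [startWord]
      split_ifs <;> simp [plain]
    simp only [Option.some.injEq] at hu hu'
    cases hr with
    | start a =>
      obtain rfl := hno i hu
      refine Or.inr (Or.inr (Or.inl ⟨_, _, .start, ?_⟩))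
      rw [← cfgWord_init]
      have : a = (w.map D.inputSym).getI 0 := by
        simpa [startWord, plain] using hu'.symm
      rw [this]
    | write u h => exact absurd hu (hcell _ _ _)
    | right b h => exact absurd hu (hcell _ _ _)
    | left b h => exact absurd hu' (hcell _ _ _)
    | accept u h hq => exact absurd hu (hcell _ _ _)
    | spreadRight u => exact absurd hu (hdone _)
    | spreadLeft u => exact absurd hu' (hdone _)
  · cases hr with
    | start a => simp [cfgWord] at hu
    | write u h =>
      obtain ⟨hi', rfl, rfl⟩ := cfgWord_head_iff.1 hu
      refine Or.inr (Or.inr (Or.inl ⟨_, _, hc.next h (step_of_machine h), ?_⟩))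
      rw [← hu']
      simpa [shift, applyStmt] using cfgWord_write hi' _ _
    | right b h =>
      obtain ⟨hi', rfl, rfl⟩ := cfgWord_head_iff.1 hu
      refine Or.inr (Or.inr (Or.inl ⟨_, _, hc.next h (step_of_machine h), ?_⟩))
      have hb : b = c.Tape.nth 1 := by
        have e : ((i + 1 : ℕ) : ℤ) - (s + 1) - z = 1 := by push_cast; omega
        rw [cfgWord, e, Option.some.injEq, Letter.cell.injEq] at hu'
        exact hu'.1.symm
      rw [hb]
      exact cfgWord_right hi' _
    | left b h =>
      obtain ⟨hi', rfl, rfl⟩ := cfgWord_head_iff.1 hu'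
      refine Or.inr (Or.inr (Or.inl ⟨_, _, hc.next h (step_of_machine h), ?_⟩))
      have hb : b = c.Tape.nth (-1) := by
        have e : (i : ℤ) - (s + 1) - z = -1 := by push_cast at hi'; omega
        rw [cfgWord, e, Option.some.injEq, Letter.cell.injEq] at hu
        exact hu.1.symm
      rw [hb]
      exact cfgWord_left hi' _
    | accept u h hq =>
      obtain ⟨hi', rfl, rfl⟩ := cfgWord_head_iff.1 hu
      exact Or.inr (Or.inr (Or.inr ((mem_of_trace hL hc (step_eq_none_iff.2 h)).2 hq)))
    | spreadRight u => simp [cfgWord] at hu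
    | spreadLeft u => simp [cfgWord] at hu'
  · exact Or.inr (Or.inr (Or.inr hw))

/-- A word is accepted if and only if its initial word can be rewritten so that the marker of
successful termination is everywhere. -/
theorem mem_iff_reaches {L : Language α} (hL : D.Decides L)
    (hs : ∀ c z, D.Trace w c z → |z| + 2 ≤ (s : ℤ)) (hJ : 2 * s ≤ J) :
    w ∈ L ↔ ∃ W, ReflTransGen (PStep J D.rules) (fun i => some (D.startWord s w i)) W ∧
      ∀ i ≤ J, W i = some .done := by
  constructor
  · intro hw
    obtain ⟨c, hr, hc, hwc⟩ := hL w
    obtain ⟨z, hz⟩ := exists_trace hr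
    exact reaches_done hs hJ hz hc (hwc.1 hw)
  · rintro ⟨W, hW, hdone⟩
    have hreach : Reachable D L s J w W := by
      clear hdone
      induction hW with
      | refl => exact Or.inr (Or.inl rfl)
      | tail _ hstep ih => exact ih.pstep hL hstep
    rcases hreach with ⟨i, hi, h⟩ | rfl | ⟨c, z, -, rfl⟩ | hw
    · simp [hdone i hi] at h
    · simpa [startWord] using hdone s (by omega)
    · simpa [cfgWord] using hdone 0 (Nat.zero_le _)
    · exact hw

end

end Decider

end SpaceBounded

/-! ### The text of the program -/

namespace CoreLang

namespace Rewriting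

/-- A text with a parameter `i`: the entry `Sum.inr k` stands for the unary notation of the number
`k + i * G`, where `G` is the size of the alphabet. -/
abbrev Template : Type := List (Sym ⊕ ℕ)

/-- The text for the value `i` of the parameter. -/
def Template.text (G : ℕ) (T : Template) (i : ℕ) : List Sym :=
  T.flatMap fun x => x.elim (fun s => [s]) fun k => unary (k + i * G)

theorem Template.text_nil (G i : ℕ) : Template.text G [] i = [] := rfl

theorem Template.text_cons_inl (G : ℕ) (s : Sym) (T : Template) (i : ℕ) :
    Template.text G (.inl s :: T) i = s :: T.text G i := rfl

theorem Template.text_cons_inr (G k : ℕ) (T : Template) (i : ℕ) :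
    Template.text G (.inr k :: T) i = unary (k + i * G) ++ T.text G i := rfl

theorem Template.text_append (G : ℕ) (T T' : Template) (i : ℕ) :
    Template.text G (T ++ T') i = T.text G i ++ T'.text G i :=
  List.flatMap_append

theorem Template.text_flatMap (G : ℕ) {β : Type} (l : List β) (f : β → Template) (i : ℕ) :
    Template.text G (l.flatMap f) i = l.flatMap fun x => (f x).text G i :=
  List.flatMap_assoc

section

variable {A : Type} [Fintype A]

/-- The number of the variable for the letter `b` at position `i + k`, as an entry of a template
with parameter `i`. -/
noncomputable def cellEntry (k : ℕ) (b : A) : Sym ⊕ ℕ :=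
  .inr (2 + letterIndex b + k * Fintype.card A)

/-- The template of the assignments that replace `u` by `v` at position `i + k`. -/
noncomputable def slotTemplate (k : ℕ) (u v : A) : Template :=
  [.inl .seq, .inl .assign, .inl .tick, .inl .mark, .inl .var, cellEntry k u] ++
    (Finset.univ : Finset A).toList.flatMap
      (fun b => [.inl .seq, .inl .assign, cellEntry k b, .inl .var, .inl .mark]) ++
    [.inl .seq, .inl .assign, cellEntry k v, .inl .var, .inl .tick, .inl .mark]

/-- The template of the alternatives in the loop body that belong to one position. -/
noncomputable def bodyTemplate (rules : List ((A × A) × (A × A))) : Template :=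
  rules.flatMap fun r =>
    .inl .choose :: (slotTemplate 0 r.1.1 r.2.1 ++ slotTemplate 1 r.1.2 r.2.2 ++ [.inl .skip])

/-- The template of the initialization of one position with the letter `b`. -/
noncomputable def cellTemplate (b : A) : Template :=
  [.inl .seq, .inl .assign, cellEntry 0 b, .inl .mul, .inl .mark, .inl .mark]

/-- The template of the final multiplications for one pair of neighbouring positions. -/
noncomputable def finalTemplate (a : A) : Template :=
  [.inl .seq, .inl .assign, .inl .tick, .inl .mark, .inl .mul, .inl .tick, .inl .mark,
    cellEntry 0 a, .inl .seq, .inl .assign, .inl .tick, .inl .mark, .inl .mul, .inl .tick,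
    .inl .mark, cellEntry 1 a]

theorem text_cellEntry (k i : ℕ) (b : A) (J : ℕ) (h : i + k ≤ J) (T : Template) :
    Template.text (Fintype.card A) (cellEntry k b :: T) i =
      unary (cellVar J (i + k) b) ++ T.text (Fintype.card A) i := by
  rw [cellEntry, Template.text_cons_inr, val_cellVar h]
  congr 2
  ring

theorem encode_assigns {n : ℕ} (l : List (Fin n × Expr n)) :
    (seqList (assigns l)).encode =
      l.flatMap (fun a => Sym.seq :: Sym.assign :: (unary a.1 ++ a.2.encode)) ++ [Sym.skip] := by
  rw [encode_seqList, assigns, List.flatMap_map]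
  rfl

theorem unary_zeroVar (J : ℕ) : unary (zeroVar A J) = [Sym.mark] := rfl

theorem unary_resVar (J : ℕ) : unary (resVar A J) = [Sym.tick, Sym.mark] := by
  rw [val_resVar]
  rfl

theorem text_slotTemplate (k i J : ℕ) (h : i + k ≤ J) (u v : A) :
    Template.text (Fintype.card A) (slotTemplate k u v) i =
      (slotAssigns J (i + k) u v).flatMap
        fun a => Sym.seq :: Sym.assign :: (unary a.1 ++ a.2.encode) := by
  simp only [slotTemplate, slotAssigns, List.cons_append, List.nil_append, Template.text_cons_inl,
    text_cellEntry _ _ _ _ h, Template.text_append, Template.text_flatMap, Template.text_nil,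
    List.append_nil, List.flatMap_cons, List.flatMap_append, List.flatMap_map, List.flatMap_nil,
    Expr.encode, unary_zeroVar, unary_resVar]

theorem encode_body (J : ℕ) (rules : List ((A × A) × (A × A))) :
    (body J rules).encode = (List.range J).flatMap
      (fun i => (bodyTemplate rules).text (Fintype.card A) i) ++ [Sym.skip] := by
  rw [body, encode_chooseList, List.flatMap_assoc]
  congr 1
  refine List.flatMap_congr fun i hi => ?_
  rw [List.mem_range] at hi
  rw [List.flatMap_map, bodyTemplate, Template.text_flatMap]
  refine List.flatMap_congr fun r _ => ?_
  rw [encode_assigns, ruleAssigns, Template.text_cons_inl, Template.text_append,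
    Template.text_append, text_slotTemplate 0 i J hi.le, text_slotTemplate 1 i J hi,
    List.flatMap_append]
  rfl

theorem encode_final (J : ℕ) (a : A) :
    (seqList (assigns (finalAssigns J a))).encode =
      [.seq, .assign, .tick, .mark, .var, .mark] ++ ((List.range J).flatMap
        (fun i => (finalTemplate a).text (Fintype.card A) i) ++ [Sym.skip]) := by
  rw [encode_assigns, finalAssigns, List.flatMap_cons, List.flatMap_assoc]
  simp only [Expr.encode, unary_zeroVar, unary_resVar, List.cons_append, List.nil_append]
  congr 7
  refine List.flatMap_congr fun i hi => ?_
  rw [List.mem_range] at hi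
  simp only [finalTemplate, Template.text_cons_inl, text_cellEntry 0 i a J hi.le,
    text_cellEntry 1 i a J hi, Template.text_nil, List.flatMap_cons, List.flatMap_nil,
    unary_resVar, List.cons_append, List.nil_append, List.append_nil, add_zero]

theorem encode_init (J : ℕ) (u : ℕ → A) :
    (seqList (assigns (initAssigns J u))).encode = (List.range (J + 1)).flatMap
      (fun i => (cellTemplate (u i)).text (Fintype.card A) i) ++ [Sym.skip] := by
  rw [encode_assigns, initAssigns, List.flatMap_map]
  congr 1
  refine List.flatMap_congr fun i hi => ?_
  have hi : i ≤ J := Nat.lt_succ_iff.1 (List.mem_range.1 hi)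
  simp only [cellTemplate, Template.text_cons_inl, text_cellEntry 0 i (u i) J hi,
    Template.text_nil, Expr.encode, unary_zeroVar, List.cons_append, List.nil_append, add_zero]

/-- A number `k + J * G` can be written by a loop over the positions, block by block. -/
theorem unary_add_mul (k J G : ℕ) :
    unary (k + J * G) = (List.range J).flatMap (fun _ => List.replicate G Sym.tick) ++ unary k := by
  induction J with
  | zero => simp
  | succ J ih =>
    have hu : ∀ a b, unary (a + b) = List.replicate a Sym.tick ++ unary b := by
      intro a b
      rw [unary, unary, List.replicate_add, List.append_assoc]
    rw [show k + (J + 1) * G = G + (k + J * G) by ring, hu, ih, ← List.append_assoc]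
    congr 1
    rw [List.range_succ_eq_map, List.flatMap_cons, List.flatMap_map]

/-- The representation of an instance, cut into fixed texts and loops over the positions. -/
theorem encode_toInstance (J : ℕ) (rules : List ((A × A) × (A × A))) (u : ℕ → A) (a : A) :
    (toInstance J rules u a).encode =
      (List.range J).flatMap (fun _ => List.replicate (Fintype.card A) Sym.tick) ++
      (unary (Fintype.card A + 2) ++ [.seq]) ++
      (List.range (J + 1)).flatMap (fun i => (cellTemplate (u i)).text (Fintype.card A) i) ++
      [.skip, .seq, .loop, .mark] ++
      (List.range J).flatMap (fun i => (bodyTemplate rules).text (Fintype.card A) i) ++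
      [.skip, .seq, .assign, .tick, .mark, .var, .mark] ++
      (List.range J).flatMap (fun i => (finalTemplate a).text (Fintype.card A) i) ++
      [.skip, .tick, .mark] ++
      (List.range J).flatMap (fun _ => List.replicate 4 Sym.tick) ++
      [.tick, .mark] := by
  have hn : unary (toInstance J rules u a).n =
      (List.range J).flatMap (fun _ => List.replicate (Fintype.card A) Sym.tick) ++
        unary (Fintype.card A + 2) := by
    rw [← unary_add_mul]
    exact congrArg unary (show Fintype.card A * (J + 1) + 2 = _ by ring)
  have hd : unary (toInstance J rules u a).d =
      (List.range J).flatMap (fun _ => List.replicate 4 Sym.tick) ++ [.tick, .mark] := by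
    have : [Sym.tick, Sym.mark] = unary 1 := rfl
    rw [this, ← unary_add_mul]
    exact congrArg unary (show 4 * J + 1 = _ by ring)
  have hj : unary (toInstance J rules u a).j = [Sym.tick, Sym.mark] := unary_resVar J
  have hp : (toInstance J rules u a).prog.encode =
      Sym.seq :: ((seqList (assigns (initAssigns J u))).encode ++
        (Sym.seq :: (Sym.loop :: (unary (zeroVar A J) ++ (body J rules).encode) ++
          (seqList (assigns (finalAssigns J a))).encode))) := rfl
  rw [Instance.encode, hn, hd, hj, hp, encode_init, encode_body, encode_final, unary_zeroVar]
  simp only [List.append_assoc, List.cons_append, List.nil_append]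

end

end Rewriting

end CoreLang

/-! ### Counters and texts on stacks -/

namespace StackProgram

open Function CoreLang CoreLang.Rewriting

/-- The stacks of the generator. -/
inductive Stk : Type
  | inp | out | tmp | rev | m | c | b | j | i | t
  deriving DecidableEq

instance : Fintype Stk where
  elems := {.inp, .out, .tmp, .rev, .m, .c, .b, .j, .i, .t}
  complete := by intro x; cases x <;> decide

/-- Input symbols on two stacks, output symbols on two stacks; the other stacks are counters. -/
def StkSym (α : Type) : Stk → Type
  | .inp => α
  | .rev => α
  | .out => Sym
  | .tmp => Sym
  | _ => Unit

instance {α : Type} [Fintype α] : ∀ k, Fintype (StkSym α k)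
  | .inp => inferInstanceAs (Fintype α)
  | .rev => inferInstanceAs (Fintype α)
  | .out => inferInstanceAs (Fintype Sym)
  | .tmp => inferInstanceAs (Fintype Sym)
  | .m => inferInstanceAs (Fintype Unit)
  | .c => inferInstanceAs (Fintype Unit)
  | .b => inferInstanceAs (Fintype Unit)
  | .j => inferInstanceAs (Fintype Unit)
  | .i => inferInstanceAs (Fintype Unit)
  | .t => inferInstanceAs (Fintype Unit)

/-- The contents of the stacks of the generator: `txt` is the text written so far, which the stack
`tmp` holds in reverse order; the counters are given by their values. -/
structure Mem (α : Type) : Type where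
  inp : List α := []
  rev : List α := []
  out : List Sym := []
  txt : List Sym := []
  m : ℕ := 0
  c : ℕ := 0
  b : ℕ := 0
  j : ℕ := 0
  i : ℕ := 0
  t : ℕ := 0

/-- A counter with value `n`. -/
def ticks (n : ℕ) : List Unit := List.replicate n ()

theorem length_ticks (n : ℕ) : (ticks n).length = n := List.length_replicate

variable {α : Type}

/-- The stacks described by a memory. -/
def Mem.stk (S : Mem α) : ∀ k, List (StkSym α k)
  | .inp => S.inp
  | .rev => S.rev
  | .out => S.out
  | .tmp => S.txt.reverse
  | .m => ticks S.m
  | .c => ticks S.c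
  | .b => ticks S.b
  | .j => ticks S.j
  | .i => ticks S.i
  | .t => ticks S.t

/-- A program for the generator transforms one memory into another one in at most `t` steps. -/
def Does (p : Prog (StkSym α)) (S S' : Mem α) (t : ℕ) : Prop := p.Runs S.stk S'.stk t

theorem Does.mono {p : Prog (StkSym α)} {S S' : Mem α} {t t' : ℕ} (h : Does p S S' t)
    (ht : t ≤ t') : Does p S S' t' := Prog.Runs.mono h ht

theorem Does.to {p : Prog (StkSym α)} {S S' S'' : Mem α} {t t' : ℕ} (h : Does p S S' t)
    (hS : S' = S'') (ht : t ≤ t') : Does p S S'' t' := hS ▸ h.mono ht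

theorem Does.seq {p q : Prog (StkSym α)} {S S' S'' : Mem α} {t t' : ℕ} (hp : Does p S S' t)
    (hq : Does q S' S'' t') : Does (p.seq q) S S'' (t + t') := Prog.Runs.seq hp hq

theorem does_skip (S : Mem α) : Does .skip S S 1 := Prog.runs_skip _

section updates

variable (S : Mem α)

theorem update_inp (x : List α) : update S.stk .inp x = { S with inp := x }.stk := by
  funext k
  cases k <;> rfl

theorem update_rev (x : List α) : update S.stk .rev x = { S with rev := x }.stk := by
  funext k
  cases k <;> rfl

theorem update_out (x : List Sym) : update S.stk .out x = { S with out := x }.stk := by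
  funext k
  cases k <;> rfl

theorem update_tmp (x : List Sym) : update S.stk .tmp x = { S with txt := x.reverse }.stk := by
  funext k
  cases k
  case tmp => exact (List.reverse_reverse x).symm
  all_goals rfl

theorem update_m (n : ℕ) : update S.stk .m (ticks n) = { S with m := n }.stk := by
  funext k
  cases k <;> rfl

theorem update_c (n : ℕ) : update S.stk .c (ticks n) = { S with c := n }.stk := by
  funext k
  cases k <;> rfl

theorem update_b (n : ℕ) : update S.stk .b (ticks n) = { S with b := n }.stk := by
  funext k
  cases k <;> rfl

theorem update_j (n : ℕ) : update S.stk .j (ticks n) = { S with j := n }.stk := by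
  funext k
  cases k <;> rfl

theorem update_i (n : ℕ) : update S.stk .i (ticks n) = { S with i := n }.stk := by
  funext k
  cases k <;> rfl

theorem update_t (n : ℕ) : update S.stk .t (ticks n) = { S with t := n }.stk := by
  funext k
  cases k <;> rfl

end updates

section push

theorem does_push_of {S S' : Mem α} {k : Stk} {a : StkSym α k}
    (h : update S.stk k (a :: S.stk k) = S'.stk) : Does (.push k a) S S' 1 := by
  rw [Does, ← h]
  exact Prog.runs_push k a S.stk

variable (S : Mem α)

theorem does_push_inp (a : α) : Does (.push .inp a) S { S with inp := a :: S.inp } 1 :=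
  does_push_of (update_inp S (a :: S.inp))

theorem does_push_rev (a : α) : Does (.push .rev a) S { S with rev := a :: S.rev } 1 :=
  does_push_of (update_rev S (a :: S.rev))

theorem does_push_out (s : Sym) : Does (.push .out s) S { S with out := s :: S.out } 1 :=
  does_push_of (update_out S (s :: S.out))

theorem does_push_tmp (s : Sym) : Does (.push .tmp s) S { S with txt := S.txt ++ [s] } 1 := by
  refine does_push_of ((update_tmp S (s :: S.txt.reverse)).trans ?_)
  rw [List.reverse_cons, List.reverse_reverse]

theorem does_push_m : Does (.push .m ()) S { S with m := S.m + 1 } 1 :=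
  does_push_of (update_m S (S.m + 1))

theorem does_push_c : Does (.push .c ()) S { S with c := S.c + 1 } 1 :=
  does_push_of (update_c S (S.c + 1))

theorem does_push_b : Does (.push .b ()) S { S with b := S.b + 1 } 1 :=
  does_push_of (update_b S (S.b + 1))

theorem does_push_j : Does (.push .j ()) S { S with j := S.j + 1 } 1 :=
  does_push_of (update_j S (S.j + 1))

theorem does_push_i : Does (.push .i ()) S { S with i := S.i + 1 } 1 :=
  does_push_of (update_i S (S.i + 1))

theorem does_push_t : Does (.push .t ()) S { S with t := S.t + 1 } 1 :=
  does_push_of (update_t S (S.t + 1))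

end push

section loop

/-- The rule for loops that are driven by a counter: `F n` describes the stacks after `n` of the `N`
iterations. -/
theorem Prog.runs_countup {K : Type} [DecidableEq K] {Γ : K → Type} {k : K} {body : Γ k → Prog Γ}
    {t : ℕ} [Subsingleton (Γ k)] (F : ℕ → ∀ k, List (Γ k)) (N : ℕ)
    (hF : ∀ n ≤ N, (F n k).length = N - n)
    (hb : ∀ n < N, ∀ a, (body a).Runs (update (F n) k (F (n + 1) k)) (F (n + 1)) t) :
    (Prog.popLoop k body).Runs (F 0) (F N) (N * (t + 1) + 1) := by
  have hsub : ∀ l l' : List (Γ k), l.length = l'.length → l = l' := by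
    intro l l' h
    exact List.ext_getElem h fun _ _ _ => Subsingleton.elim _ _
  have hlen : (F 0 k).length = N := hF 0 (Nat.zero_le _)
  have h := Prog.runs_popLoop (k := k) (body := body) (t := t)
    (fun l => F (N - l.length)) (F 0 k) ?_ ?_
  · simpa [hlen] using h
  · intro l hl
    have hl := hl.length_le
    refine hsub _ _ ?_
    rw [hF _ (Nat.sub_le _ _)]
    omega
  · intro a l hl
    have hl := hl.length_le
    rw [List.length_cons] at hl
    simp only [List.length_cons]
    have e : N - l.length = N - (l.length + 1) + 1 := by omega
    have := hb (N - (l.length + 1)) (by omega) a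
    rw [← e] at this
    rwa [← hsub l (F (N - l.length) k) (by rw [hF _ (Nat.sub_le _ _)]; omega)] at this

variable {t : ℕ} {p : Prog (StkSym α)} (F : ℕ → Mem α) (N : ℕ)

theorem does_loop_m (hF : ∀ n ≤ N, (F n).m = N - n)
    (hb : ∀ n < N, Does p { F n with m := (F (n + 1)).m } (F (n + 1)) t) :
    Does (.popLoop .m fun _ => p) (F 0) (F N) (N * (t + 1) + 1) := by
  have : Subsingleton (StkSym α .m) := inferInstanceAs (Subsingleton Unit)
  refine Prog.runs_countup (fun n => (F n).stk) N (fun n hn => (length_ticks _).trans (hF n hn))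
    fun n hn _ => ?_
  have := hb n hn
  rwa [Does, ← update_m] at this

theorem does_loop_c (hF : ∀ n ≤ N, (F n).c = N - n)
    (hb : ∀ n < N, Does p { F n with c := (F (n + 1)).c } (F (n + 1)) t) :
    Does (.popLoop .c fun _ => p) (F 0) (F N) (N * (t + 1) + 1) := by
  have : Subsingleton (StkSym α .c) := inferInstanceAs (Subsingleton Unit)
  refine Prog.runs_countup (fun n => (F n).stk) N (fun n hn => (length_ticks _).trans (hF n hn))
    fun n hn _ => ?_
  have := hb n hn
  rwa [Does, ← update_c] at this

theorem does_loop_b (hF : ∀ n ≤ N, (F n).b = N - n)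
    (hb : ∀ n < N, Does p { F n with b := (F (n + 1)).b } (F (n + 1)) t) :
    Does (.popLoop .b fun _ => p) (F 0) (F N) (N * (t + 1) + 1) := by
  have : Subsingleton (StkSym α .b) := inferInstanceAs (Subsingleton Unit)
  refine Prog.runs_countup (fun n => (F n).stk) N (fun n hn => (length_ticks _).trans (hF n hn))
    fun n hn _ => ?_
  have := hb n hn
  rwa [Does, ← update_b] at this

theorem does_loop_j (hF : ∀ n ≤ N, (F n).j = N - n)
    (hb : ∀ n < N, Does p { F n with j := (F (n + 1)).j } (F (n + 1)) t) :
    Does (.popLoop .j fun _ => p) (F 0) (F N) (N * (t + 1) + 1) := by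
  have : Subsingleton (StkSym α .j) := inferInstanceAs (Subsingleton Unit)
  refine Prog.runs_countup (fun n => (F n).stk) N (fun n hn => (length_ticks _).trans (hF n hn))
    fun n hn _ => ?_
  have := hb n hn
  rwa [Does, ← update_j] at this

theorem does_loop_i (hF : ∀ n ≤ N, (F n).i = N - n)
    (hb : ∀ n < N, Does p { F n with i := (F (n + 1)).i } (F (n + 1)) t) :
    Does (.popLoop .i fun _ => p) (F 0) (F N) (N * (t + 1) + 1) := by
  have : Subsingleton (StkSym α .i) := inferInstanceAs (Subsingleton Unit)
  refine Prog.runs_countup (fun n => (F n).stk) N (fun n hn => (length_ticks _).trans (hF n hn))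
    fun n hn _ => ?_
  have := hb n hn
  rwa [Does, ← update_i] at this

theorem does_loop_t (hF : ∀ n ≤ N, (F n).t = N - n)
    (hb : ∀ n < N, Does p { F n with t := (F (n + 1)).t } (F (n + 1)) t) :
    Does (.popLoop .t fun _ => p) (F 0) (F N) (N * (t + 1) + 1) := by
  have : Subsingleton (StkSym α .t) := inferInstanceAs (Subsingleton Unit)
  refine Prog.runs_countup (fun n => (F n).stk) N (fun n hn => (length_ticks _).trans (hF n hn))
    fun n hn _ => ?_
  have := hb n hn
  rwa [Does, ← update_t] at this

end loop

section emit

/-- Writes a fixed text. -/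
def emit (L : List Sym) : Prog (StkSym α) := L.foldr (fun s p => .seq (.push .tmp s) p) .skip

theorem does_emit (L : List Sym) (S : Mem α) :
    Does (emit L) S { S with txt := S.txt ++ L } (L.length + 1) := by
  induction L generalizing S with
  | nil =>
    rw [List.append_nil]
    exact does_skip S
  | cons s L ih =>
    have := (does_push_tmp S s).seq (ih { S with txt := S.txt ++ [s] })
    simp only [List.append_assoc, List.singleton_append] at this
    exact this.mono (by simp; omega)

/-- Writes the unary notation of `k + i * G`, where `i` is the value of the counter. -/
def emitIndex (G k : ℕ) : Prog (StkSym α) :=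
  .seq (.popLoop .i fun _ => .seq (emit (List.replicate G .tick)) (.push .t ()))
    (.seq (.popLoop .t fun _ => .push .i ()) (emit (unary k)))

theorem does_emitIndex (G k : ℕ) (S : Mem α) (ht : S.t = 0) :
    Does (emitIndex G k) S { S with txt := S.txt ++ unary (k + S.i * G) }
      ((G + k + 9) * (S.i + 1)) := by
  have h₁ := does_loop_i (α := α) (t := G + 2)
    (p := .seq (emit (List.replicate G .tick)) (.push .t ()))
    (fun n => { S with
      i := S.i - n, t := n
      txt := S.txt ++ (List.range n).flatMap fun _ => List.replicate G .tick }) S.i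
    (fun n _ => rfl) (fun n hn => by
      refine Does.to (Does.seq (does_emit _ _) (does_push_t _)) ?_ ?_
      · simp [List.range_succ]
      · simp)
  have h₂ := does_loop_t (α := α) (t := 1) (p := .push .i ())
    (fun n => { S with
      i := n, t := S.i - n
      txt := S.txt ++ (List.range S.i).flatMap fun _ => List.replicate G .tick }) S.i
    (fun n _ => rfl) (fun n hn => does_push_i _)
  simp only [Nat.sub_zero, Nat.sub_self, List.range_zero, List.flatMap_nil, List.append_nil]
    at h₁ h₂
  have h₃ := h₁.seq (h₂.seq (does_emit (unary k) _))
  simp only [List.append_assoc, ← unary_add_mul] at h₃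
  obtain ⟨inp, rev, out, txt, m, c, b, j, i, t⟩ := S
  obtain rfl : t = 0 := ht
  refine h₃.mono ?_
  simp only [unary, List.length_append, List.length_replicate, List.length_singleton]
  nlinarith [Nat.zero_le (k * i)]

/-- Writes the text of a template, with the value of the counter `i` as the parameter. -/
def emitTemplate (G : ℕ) (T : Template) : Prog (StkSym α) :=
  T.foldr (fun x p => .seq (x.elim (fun s => .push .tmp s) (emitIndex G)) p) .skip

/-- A bound for the time that `emitTemplate` takes, up to the factor `i + 1`. -/
def templateCost (G : ℕ) (T : Template) : ℕ :=
  (T.map fun x => x.elim (fun _ => 1) fun k => G + k + 9).sum + 1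

theorem does_emitTemplate (G : ℕ) (T : Template) (S : Mem α) (ht : S.t = 0) :
    Does (emitTemplate G T) S { S with txt := S.txt ++ T.text G S.i }
      (templateCost G T * (S.i + 1)) := by
  induction T generalizing S with
  | nil =>
    have := (does_skip S).mono (show 1 ≤ templateCost G [] * (S.i + 1) by simp [templateCost])
    simpa [emitTemplate, Template.text_nil] using this
  | cons x T ih =>
    rcases x with s | k
    · have := (does_push_tmp S s).seq (ih { S with txt := S.txt ++ [s] } ht)
      simp only [List.append_assoc, List.singleton_append, ← Template.text_cons_inl] at this
      refine this.mono ?_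
      simp only [templateCost, List.map_cons, List.sum_cons, Sum.elim_inl]
      nlinarith
    · have := (does_emitIndex G k S ht).seq
        (ih { S with txt := S.txt ++ unary (k + S.i * G) } ht)
      simp only [List.append_assoc, ← Template.text_cons_inr] at this
      refine this.mono ?_
      simp only [templateCost, List.map_cons, List.sum_cons, Sum.elim_inr]
      apply le_of_eq
      ring

/-- Runs `p` for each value `i < j`, and restores the counter `j`. -/
def forRange (p : Prog (StkSym α)) : Prog (StkSym α) :=
  .seq (.popLoop .j fun _ => .seq p (.push .i ())) (.popLoop .i fun _ => .push .j ())

theorem does_forRange {p : Prog (StkSym α)} {f : ℕ → List Sym} {S : Mem α} {t : ℕ} (hi : S.i = 0)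
    (hp : ∀ S' : Mem α, S'.t = S.t → S'.i < S.j →
      Does p S' { S' with txt := S'.txt ++ f S'.i } t) :
    Does (forRange p) S { S with txt := S.txt ++ (List.range S.j).flatMap f }
      (S.j * (t + 4) + 2) := by
  have h₁ := does_loop_j (α := α) (t := t + 1) (p := .seq p (.push .i ()))
    (fun n => { S with
      j := S.j - n, i := n, txt := S.txt ++ (List.range n).flatMap f }) S.j
    (fun n _ => rfl) (fun n hn => by
      refine Does.to (Does.seq (hp _ ?_ ?_) (does_push_i _)) ?_ le_rfl
      · rfl
      · exact hn
      · simp [List.range_succ])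
  have h₂ := does_loop_i (α := α) (t := 1) (p := .push .j ())
    (fun n => { S with
      j := n, i := S.j - n, txt := S.txt ++ (List.range S.j).flatMap f }) S.j
    (fun n _ => rfl) (fun n hn => does_push_j _)
  simp only [Nat.sub_zero, Nat.sub_self, List.range_zero, List.flatMap_nil, List.append_nil]
    at h₁ h₂
  obtain ⟨inp, rev, out, txt, m, c, b, j, i, t⟩ := S
  obtain rfl : i = 0 := hi
  refine (h₁.seq h₂).mono ?_
  apply le_of_eq
  ring

end emit

end StackProgram

/-! ### The generator of the instances -/

namespace StackProgram

open Function CoreLang CoreLang.Rewriting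

variable {α : Type}

section prepare

theorem does_loop_inp {t : ℕ} {body : α → Prog (StkSym α)} (F : List α → Mem α) (L : List α)
    (hF : ∀ l, l <:+ L → (F l).inp = l)
    (hb : ∀ a l, a :: l <:+ L → Does (body a) { F (a :: l) with inp := l } (F l) t) :
    Does (.popLoop .inp body) (F L) (F []) (L.length * (t + 1) + 1) := by
  refine Prog.runs_popLoop (Γ := StkSym α) (k := .inp) (fun l => (F l).stk) L hF fun a l hl => ?_
  exact (congrArg (fun T => (body a).Runs T (F l).stk t) (update_inp (F (a :: l)) l)).mpr
    (hb a l hl)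

theorem does_loop_rev {t : ℕ} {body : α → Prog (StkSym α)} (F : List α → Mem α) (L : List α)
    (hF : ∀ l, l <:+ L → (F l).rev = l)
    (hb : ∀ a l, a :: l <:+ L → Does (body a) { F (a :: l) with rev := l } (F l) t) :
    Does (.popLoop .rev body) (F L) (F []) (L.length * (t + 1) + 1) := by
  refine Prog.runs_popLoop (Γ := StkSym α) (k := .rev) (fun l => (F l).stk) L hF fun a l hl => ?_
  exact (congrArg (fun T => (body a).Runs T (F l).stk t) (update_rev (F (a :: l)) l)).mpr
    (hb a l hl)

theorem does_loop_tmp {t : ℕ} {body : Sym → Prog (StkSym α)} (F : List Sym → Mem α) (L : List Sym)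
    (hF : ∀ l, l <:+ L → (F l).txt = l.reverse)
    (hb : ∀ a l, a :: l <:+ L → Does (body a) { F (a :: l) with txt := l.reverse } (F l) t) :
    Does (.popLoop .tmp body) (F L) (F []) (L.length * (t + 1) + 1) := by
  refine Prog.runs_popLoop (Γ := StkSym α) (k := .tmp) (fun l => (F l).stk) L
    (fun l hl => ?_) fun a l hl => ?_
  · exact (congrArg List.reverse (hF l hl)).trans (List.reverse_reverse (α := Sym) l)
  · exact (congrArg (fun T => (body a).Runs T (F l).stk t) (update_tmp (F (a :: l)) l)).mpr
      (hb a l hl)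

/-- Counts the input symbols. -/
def countInput : Prog (StkSym α) :=
  .seq (.popLoop .inp fun a => .push .rev a)
    (.popLoop .rev fun a => .seq (.push .inp a) (.push .m ()))

theorem does_countInput (w : List α) :
    Does countInput { inp := w } { inp := w, m := w.length } (5 * w.length + 2) := by
  have h₁ := does_loop_inp (t := 1) (body := fun a => .push .rev a)
    (fun l => { inp := l, rev := (w.take (w.length - l.length)).reverse }) w (fun l _ => rfl)
    (by
      rintro a l ⟨p, rfl⟩
      refine Does.to (does_push_rev _ _) ?_ le_rfl
      have e₁ : (p ++ a :: l).take ((p ++ a :: l).length - (a :: l).length) = p := by simp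
      have e₂ : (p ++ a :: l).take ((p ++ a :: l).length - l.length) = p ++ [a] := by
        have : p ++ a :: l = (p ++ [a]) ++ l := by simp
        rw [this, List.length_append (bs := l), Nat.add_sub_cancel, List.take_left]
      simp only [e₁, e₂, List.reverse_append, List.reverse_singleton, List.singleton_append])
  have h₂ := does_loop_rev (t := 2) (body := fun a => .seq (.push .inp a) (.push .m ()))
    (fun l => { inp := w.drop l.length, rev := l, m := w.length - l.length }) w.reverse
    (fun l _ => rfl)
    (by
      rintro a l ⟨p, hp⟩
      have hw : w = l.reverse ++ a :: p.reverse := by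
        rw [← List.reverse_reverse w, ← hp]
        simp
      subst hw
      refine Does.to (Does.seq (does_push_inp _ _) (does_push_m _)) ?_ le_rfl
      have e₁ : (l.reverse ++ a :: p.reverse).drop (a :: l).length = p.reverse := by
        have : l.reverse ++ a :: p.reverse = (l.reverse ++ [a]) ++ p.reverse := by simp
        rw [this, List.drop_left']
        simp
      have e₂ : (l.reverse ++ a :: p.reverse).drop l.length = a :: p.reverse := by
        rw [List.drop_left']
        simp
      simp only [e₁, e₂, Mem.mk.injEq, true_and, and_true]
      simp
      omega)
  simp only [List.length_nil, Nat.sub_zero, List.take_length, Nat.sub_self, List.take_zero,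
    List.reverse_nil, List.length_reverse, List.drop_length, List.drop_zero] at h₁ h₂
  exact (h₁.seq h₂).mono (by omega)

/-- Adds `n` to the counter `c`. -/
def addConst : ℕ → Prog (StkSym α)
  | 0 => .skip
  | n + 1 => .seq (.push .c ()) (addConst n)

theorem does_addConst (n : ℕ) (S : Mem α) :
    Does (addConst n) S { S with c := S.c + n } (n + 1) := by
  induction n generalizing S with
  | zero => exact does_skip S
  | succ n ih =>
    refine Does.to (Does.seq (does_push_c S) (ih _)) ?_ (by omega)
    simp only [Nat.add_assoc, Nat.add_comm 1 n]

/-- Adds the counter `m` and one more to the counter `b`. -/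
def addInputLength : Prog (StkSym α) :=
  .seq (.popLoop .m fun _ => .seq (.push .t ()) (.push .b ()))
    (.seq (.popLoop .t fun _ => .push .m ()) (.push .b ()))

theorem does_addInputLength (S : Mem α) (ht : S.t = 0) :
    Does addInputLength S { S with b := S.b + (S.m + 1) } (5 * S.m + 3) := by
  have h₁ := does_loop_m (α := α) (t := 2) (p := .seq (.push .t ()) (.push .b ()))
    (fun n => { S with m := S.m - n, t := n, b := S.b + n }) S.m (fun n _ => rfl)
    (fun n _ => Does.seq (does_push_t _) (does_push_b _))
  have h₂ := does_loop_t (α := α) (t := 1) (p := .push .m ())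
    (fun n => { S with m := n, t := S.m - n, b := S.b + S.m }) S.m (fun n _ => rfl)
    (fun n _ => does_push_m _)
  simp only [Nat.sub_zero, Nat.sub_self] at h₁ h₂
  have h₃ := h₁.seq (h₂.seq (does_push_b _))
  obtain ⟨inp, rev, out, txt, m, c, b, j, i, t⟩ := S
  obtain rfl : t = 0 := ht
  exact h₃.mono (by simp only; omega)

/-- Multiplies the counter `c` by `m + 1`. -/
def mulStep : Prog (StkSym α) :=
  .seq (.popLoop .c fun _ => addInputLength) (.popLoop .b fun _ => .push .c ())

theorem does_mulStep (S : Mem α) (ht : S.t = 0) (hb : S.b = 0) :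
    Does mulStep S { S with c := S.c * (S.m + 1) } (7 * (S.c * (S.m + 1)) + 2) := by
  have h₁ := does_loop_c (α := α) (t := 5 * S.m + 3) (p := addInputLength)
    (fun n => { S with c := S.c - n, b := n * (S.m + 1) }) S.c (fun n _ => rfl)
    (fun n _ => by
      refine Does.to (does_addInputLength _ ht) ?_ le_rfl
      simp only [Nat.succ_mul])
  have h₂ := does_loop_b (α := α) (t := 1) (p := .push .c ())
    (fun n => { S with c := n, b := S.c * (S.m + 1) - n }) (S.c * (S.m + 1)) (fun n _ => rfl)
    (fun n _ => does_push_c _)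
  simp only [Nat.sub_zero, Nat.sub_self, Nat.zero_mul] at h₁ h₂
  obtain ⟨inp, rev, out, txt, m, c, b, j, i, t⟩ := S
  obtain rfl : b = 0 := hb
  refine (h₁.seq h₂).mono ?_
  simp only
  nlinarith

/-- Multiplies the counter `c` by `(m + 1) ^ k`. -/
def mulPow : ℕ → Prog (StkSym α)
  | 0 => .skip
  | k + 1 => .seq (mulPow k) mulStep

theorem does_mulPow (k : ℕ) (S : Mem α) (ht : S.t = 0) (hb : S.b = 0) :
    Does (mulPow k) S { S with c := S.c * (S.m + 1) ^ k }
      (k * (7 * (S.c * (S.m + 1) ^ k) + 2) + 1) := by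
  induction k with
  | zero =>
    refine Does.to (does_skip S) ?_ (by omega)
    simp
  | succ k ih =>
    refine Does.to (Does.seq ih (does_mulStep { S with c := S.c * (S.m + 1) ^ k } ht hb)) ?_ ?_
    · simp only [pow_succ, Nat.mul_assoc]
    · have h : S.c * (S.m + 1) ^ k ≤ S.c * (S.m + 1) ^ (k + 1) :=
        Nat.mul_le_mul_left _ (Nat.pow_le_pow_right (Nat.succ_pos _) (Nat.le_succ k))
      have h' := Nat.mul_le_mul_left k h
      simp only [pow_succ, ← Nat.mul_assoc] at h h' ⊢
      linarith

/-- Computes the last position `j = 2 * c + m`. -/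
def computeLast : Prog (StkSym α) :=
  .seq (.popLoop .c fun _ => .seq (.push .j ()) (.seq (.push .j ()) (.push .b ())))
    (.seq (.popLoop .b fun _ => .push .c ()) (.popLoop .m fun _ => .push .j ()))

theorem does_computeLast (S : Mem α) (hb : S.b = 0) (hj : S.j = 0) :
    Does computeLast S { S with m := 0, j := 2 * S.c + S.m } (6 * S.c + 2 * S.m + 3) := by
  have h₁ := does_loop_c (α := α) (t := 3)
    (p := .seq (.push .j ()) (.seq (.push .j ()) (.push .b ())))
    (fun n => { S with c := S.c - n, b := n, j := 2 * n }) S.c (fun n _ => rfl)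
    (fun n _ => Does.seq (does_push_j _) (Does.seq (does_push_j _) (does_push_b _)))
  have h₂ := does_loop_b (α := α) (t := 1) (p := .push .c ())
    (fun n => { S with c := n, b := S.c - n, j := 2 * S.c }) S.c (fun n _ => rfl)
    (fun n _ => does_push_c _)
  have h₃ := does_loop_m (α := α) (t := 1) (p := .push .j ())
    (fun n => { S with m := S.m - n, b := 0, j := 2 * S.c + n }) S.m (fun n _ => rfl)
    (fun n _ => does_push_j _)
  simp only [Nat.sub_zero, Nat.sub_self, Nat.mul_zero, Nat.add_zero] at h₁ h₂ h₃
  have h₄ := h₁.seq (h₂.seq h₃)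
  obtain ⟨inp, rev, out, txt, m, c, b, j, i, t⟩ := S
  obtain rfl : b = 0 := hb
  obtain rfl : j = 0 := hj
  exact h₄.mono (by simp only; omega)

/-- Moves the text to the output stack. -/
def moveOutput : Prog (StkSym α) := .popLoop .tmp fun s => .push .out s

theorem does_moveOutput (L : List Sym) :
    Does (α := α) moveOutput { txt := L } { out := L } (2 * L.length + 1) := by
  have h := does_loop_tmp (α := α) (t := 1) (body := fun s => .push .out s)
    (fun l => { txt := l.reverse, out := L.drop l.length }) L.reverse (fun l _ => rfl)
    (by
      rintro a l ⟨p, hp⟩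
      have hw : L = l.reverse ++ a :: p.reverse := by
        rw [← List.reverse_reverse L, ← hp]
        simp
      subst hw
      refine Does.to (does_push_out _ _) ?_ le_rfl
      have e₁ : (l.reverse ++ a :: p.reverse).drop (a :: l).length = p.reverse := by
        have : l.reverse ++ a :: p.reverse = (l.reverse ++ [a]) ++ p.reverse := by simp
        rw [this, List.drop_left']
        simp
      have e₂ : (l.reverse ++ a :: p.reverse).drop l.length = a :: p.reverse := by
        rw [List.drop_left']
        simp
      simp only [e₁, e₂])
  simp only [List.reverse_reverse, List.length_reverse, List.drop_length, List.reverse_nil,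
    List.length_nil, List.drop_zero] at h
  exact h.mono (by omega)

end prepare

section generate

variable {A : Type} [Fintype A]

/-- The text of the initialization of the positions below `k`. -/
noncomputable def initText (u : ℕ → A) (k : ℕ) : List Sym :=
  (List.range k).flatMap fun i => (cellTemplate (u i)).text (Fintype.card A) i

/-- A bound for the cost of the initialization of one position. -/
noncomputable def cellCost (A : Type) [Fintype A] : ℕ :=
  ∑ b : A, templateCost (Fintype.card A) (cellTemplate b)

theorem templateCost_le_cellCost (b : A) :
    templateCost (Fintype.card A) (cellTemplate b) ≤ cellCost A :=
  Finset.single_le_sum (f := fun b : A => templateCost (Fintype.card A) (cellTemplate b))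
    (fun _ _ => Nat.zero_le _) (Finset.mem_univ b)

/-- Writes the initialization of the position `i` with the letter `b` and increments `i`. -/
noncomputable def emitCell (b : A) : Prog (StkSym α) :=
  .seq (emitTemplate (Fintype.card A) (cellTemplate b)) (.push .i ())

/-- The text after the fixed prefix `T` is kept in the form `initText u i`, so that the parts
of `emitInit` fit together. -/
theorem does_emitCell {u : ℕ → A} {b : A} {T : List Sym} {J : ℕ} {S S' : Mem α} (ht : S.t = 0)
    (hi : S.i ≤ J) (hu : u S.i = b) (hT : S.txt = T ++ initText u S.i)
    (hS : S' = { S with i := S.i + 1, txt := T ++ initText u (S.i + 1) }) :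
    Does (emitCell b) S S' (cellCost A * (J + 1) + 1) := by
  refine Does.to (Does.seq (does_emitTemplate _ _ _ ht) (does_push_i _)) ?_ ?_
  · rw [hS]
    simp only [hT, initText, List.range_succ, List.flatMap_append, List.flatMap_singleton, hu,
      List.append_assoc]
  · exact Nat.add_le_add_right
      (Nat.mul_le_mul (templateCost_le_cellCost b) (Nat.succ_le_succ hi)) 1

/-- Writes the initialization of all positions with the word that consists of `c` letters `blank`,
the letter `start`, the letters for the input, and again `c` letters `blank`. -/
noncomputable def emitInit (blank start : A) (letter : α → A) : Prog (StkSym α) :=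
  .seq (.popLoop .c fun _ => .seq (emitCell blank) (.push .b ()))
    (.seq (emitCell start)
      (.seq (.popLoop .inp fun a => emitCell (letter a))
        (.seq (.popLoop .b fun _ => emitCell blank) (.popLoop .i fun _ => .skip))))

theorem does_emitInit {blank start : A} {letter : α → A} {u : ℕ → A} {s : ℕ} {w : List α}
    (h₁ : ∀ i < s, u i = blank) (h₂ : u s = start)
    (h₃ : ∀ i a, w[i]? = some a → u (s + 1 + i) = letter a)
    (h₄ : ∀ i, u (s + 1 + w.length + i) = blank)
    {J : ℕ} (hJ : J = 2 * s + w.length) (T : List Sym) :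
    Does (emitInit blank start letter) { inp := w, txt := T, c := s, j := J }
      { txt := T ++ initText u (J + 1), j := J }
      ((J + 1) * (cellCost A * (J + 1) + 5) + 4) := by
  set K := cellCost A * (J + 1) + 1 with hK
  have e₁ := does_loop_c (α := α) (t := K + 1) (p := .seq (emitCell blank) (.push .b ()))
    (fun n => { inp := w, txt := T ++ initText u n, c := s - n, j := J, b := n, i := n }) s
    (fun n _ => rfl)
    (fun n hn => Does.seq (does_emitCell (u := u) (T := T) (J := J) rfl (by simp only; omega)
      (h₁ n hn) rfl rfl) (does_push_b _))
  have e₂ : Does (α := α) (emitCell start)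
      { inp := w, txt := T ++ initText u s, j := J, b := s, i := s }
      { inp := w, txt := T ++ initText u (s + 1), j := J, b := s, i := s + 1 } K :=
    does_emitCell (u := u) (T := T) (J := J) rfl (by simp only; omega) h₂ rfl rfl
  have e₃ := does_loop_inp (t := K) (body := fun a => emitCell (letter a))
    (fun l => { inp := l, txt := T ++ initText u (s + 1 + (w.length - l.length)), j := J, b := s,
                i := s + 1 + (w.length - l.length) }) w (fun l _ => rfl)
    (by
      rintro a l ⟨p, hp⟩
      have hlen : w.length = p.length + (l.length + 1) := by rw [← hp]; simp
      have hl₁ : w.length - (a :: l).length = p.length := by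
        rw [hlen, List.length_cons, Nat.add_sub_cancel]
      have hl₂ : w.length - l.length = p.length + 1 := by omega
      rw [hl₁, hl₂]
      refine does_emitCell (u := u) (T := T) (J := J) rfl (by simp only; omega)
        (h₃ _ _ ?_) rfl rfl
      rw [← hp]
      simp)
  have e₄ := does_loop_b (α := α) (t := K) (p := emitCell blank)
    (fun n => { txt := T ++ initText u (s + 1 + w.length + n), j := J, b := s - n,
                i := s + 1 + w.length + n }) s (fun n _ => rfl)
    (fun n hn => does_emitCell (u := u) (T := T) (J := J) rfl (by simp only; omega)
      (h₄ n) rfl rfl)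
  have e₅ := does_loop_i (α := α) (t := 1) (p := .skip)
    (fun n => { txt := T ++ initText u (J + 1), j := J, i := J + 1 - n }) (J + 1)
    (fun n _ => rfl) (fun n _ => does_skip _)
  have hJ' : s + 1 + w.length + s = J + 1 := by omega
  simp only [Nat.sub_zero, Nat.sub_self, List.length_nil, Nat.add_zero, hJ'] at e₁ e₃ e₄ e₅
  have e₀ : initText u 0 = [] := rfl
  rw [e₀, List.append_nil] at e₁
  refine (e₁.seq (e₂.seq (e₃.seq (e₄.seq e₅)))).mono ?_
  rw [← hJ', hK, hJ]
  ring_nf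
  nlinarith [Nat.zero_le s, Nat.zero_le w.length]

/-- The generator for the instances with the word described above, where `c` is
`c₀ * (m + 1) ^ k` for an input of length `m`. -/
noncomputable def generator (c₀ k : ℕ) (blank start done : A) (letter : α → A)
    (rules : List ((A × A) × (A × A))) : Prog (StkSym α) :=
  .seq countInput <| .seq (addConst c₀) <| .seq (mulPow k) <| .seq computeLast <|
  .seq (forRange (emit (List.replicate (Fintype.card A) .tick))) <|
  .seq (emit (unary (Fintype.card A + 2) ++ [.seq])) <|
  .seq (emitInit blank start letter) <|
  .seq (emit [.skip, .seq, .loop, .mark]) <|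
  .seq (forRange (emitTemplate (Fintype.card A) (bodyTemplate rules))) <|
  .seq (emit [.skip, .seq, .assign, .tick, .mark, .var, .mark]) <|
  .seq (forRange (emitTemplate (Fintype.card A) (finalTemplate done))) <|
  .seq (emit [.skip, .tick, .mark]) <|
  .seq (forRange (emit (List.replicate 4 .tick))) <|
  .seq (emit [.tick, .mark]) <|
  .seq (.popLoop .j fun _ => .skip) moveOutput

theorem length_text_le (G : ℕ) (T : Template) (i : ℕ) :
    (T.text G i).length ≤ templateCost G T * (i + 1) := by
  induction T with
  | nil => simp [Template.text_nil]
  | cons x T ih =>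
    rcases x with s | k
    · simp only [Template.text_cons_inl, List.length_cons, templateCost, List.map_cons,
        List.sum_cons, Sum.elim_inl] at ih ⊢
      nlinarith
    · simp only [Template.text_cons_inr, List.length_append, unary, List.length_replicate,
        List.length_singleton, templateCost, List.map_cons, List.sum_cons, Sum.elim_inr] at ih ⊢
      nlinarith [Nat.zero_le (k * i)]

theorem length_flatMap_range_le {f : ℕ → List Sym} {N B : ℕ} (h : ∀ i < N, (f i).length ≤ B) :
    ((List.range N).flatMap f).length ≤ N * B := by
  rw [List.length_flatMap]
  refine (List.sum_le_card_nsmul _ B ?_).trans (by simp)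
  simp only [List.mem_map, List.mem_range]
  rintro _ ⟨i, hi, rfl⟩
  exact h i hi

/-- A bound for the running time of the generator in terms of the length `m` of the input and the
numbers `s` and `J` of blanks and of positions.  It is stated for all semirings, so that it can be
used for numbers and for polynomials. -/
def timeBound {R : Type} [CommSemiring R] (c₀ k G K₁ K₂ K₃ : ℕ) (m s J : R) : R :=
  5 * m + c₀ + k * (7 * s + 2) + 6 * s + 2 * m + J * (3 * G + 40) + 3 * G +
    (J + 1) * (J + 1) * (3 * K₁ + 3 * K₂ + 3 * K₃ + 5) + 100

/-- The word `u` is given by its letters in the parts of the word that `emitInit` treats separately. -/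
theorem does_generator {blank start done : A} {letter : α → A} {rules : List ((A × A) × (A × A))}
    {c₀ k s J : ℕ} {u : ℕ → A} {w : List α}
    (hs : s = c₀ * (w.length + 1) ^ k) (hJ : J = 2 * s + w.length)
    (h₁ : ∀ i < s, u i = blank) (h₂ : u s = start)
    (h₃ : ∀ i a, w[i]? = some a → u (s + 1 + i) = letter a)
    (h₄ : ∀ i, u (s + 1 + w.length + i) = blank) :
    Does (generator c₀ k blank start done letter rules) { inp := w }
      { out := (toInstance J rules u done).encode }
      (timeBound c₀ k (Fintype.card A) (cellCost A)
        (templateCost (Fintype.card A) (bodyTemplate rules))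
        (templateCost (Fintype.card A) (finalTemplate done)) w.length s J) := by
  set G := Fintype.card A with hG
  set K₁ := cellCost A with hK₁
  set K₂ := templateCost G (bodyTemplate rules) with hK₂
  set K₃ := templateCost G (finalTemplate done) with hK₃
  have hT : ∀ (T : Template) (S' : Mem α), S'.t = 0 → S'.i < J →
      Does (emitTemplate G T) S' { S' with txt := S'.txt ++ T.text G S'.i }
        (templateCost G T * (J + 1)) := fun T S' ht hi =>
    (does_emitTemplate G T S' ht).mono (Nat.mul_le_mul_left _ (by omega))
  have hrange : ∀ {p : Prog (StkSym α)} {t : ℕ} (f : ℕ → List Sym) (T T' : List Sym),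
      T' = T ++ (List.range J).flatMap f →
      (∀ S' : Mem α, S'.t = 0 → S'.i < J → Does p S' { S' with txt := S'.txt ++ f S'.i } t) →
      Does (forRange p) { txt := T, j := J } { txt := T', j := J } (J * (t + 4) + 2) := by
    rintro p t f T T' rfl hp
    exact does_forRange (S := { txt := T, j := J }) rfl hp
  have hemit : ∀ (L T T' : List Sym), T' = T ++ L →
      Does (α := α) (emit L) { txt := T, j := J } { txt := T', j := J } (L.length + 1) := by
    rintro L T T' rfl
    exact does_emit L _
  -- the text after each of the pieces of the program
  obtain ⟨T₁, hT₁⟩ : ∃ T, T = (List.range J).flatMap fun _ => List.replicate G Sym.tick :=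
    ⟨_, rfl⟩
  obtain ⟨T₂, hT₂⟩ : ∃ T, T = T₁ ++ (unary (G + 2) ++ [.seq]) := ⟨_, rfl⟩
  obtain ⟨T₃, hT₃⟩ : ∃ T, T = T₂ ++ initText u (J + 1) := ⟨_, rfl⟩
  obtain ⟨T₄, hT₄⟩ : ∃ T, T = T₃ ++ [.skip, .seq, .loop, .mark] := ⟨_, rfl⟩
  obtain ⟨T₅, hT₅⟩ : ∃ T, T = T₄ ++
    (List.range J).flatMap fun i => (bodyTemplate rules).text G i := ⟨_, rfl⟩
  obtain ⟨T₆, hT₆⟩ : ∃ T, T = T₅ ++ [.skip, .seq, .assign, .tick, .mark, .var, .mark] := ⟨_, rfl⟩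
  obtain ⟨T₇, hT₇⟩ : ∃ T, T = T₆ ++
    (List.range J).flatMap fun i => (finalTemplate done).text G i := ⟨_, rfl⟩
  obtain ⟨T₈, hT₈⟩ : ∃ T, T = T₇ ++ [.skip, .tick, .mark] := ⟨_, rfl⟩
  obtain ⟨T₉, hT₉⟩ : ∃ T, T = T₈ ++
    (List.range J).flatMap fun _ => List.replicate 4 Sym.tick := ⟨_, rfl⟩
  obtain ⟨T, hTT⟩ : ∃ T, T = T₉ ++ [.tick, .mark] := ⟨_, rfl⟩
  have hcode : (toInstance J rules u done).encode = T := by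
    rw [encode_toInstance, hTT, hT₉, hT₈, hT₇, hT₆, hT₅, hT₄, hT₃, hT₂, hT₁, initText]
  have hlen : T.length ≤ J * G + (G + 4) + (J + 1) * (K₁ * (J + 1)) + 4 + J * (K₂ * (J + 1)) + 7 +
      J * (K₃ * (J + 1)) + 3 + J * 4 + 2 := by
    have l₁ : T₁.length ≤ J * G := by
      rw [hT₁]
      exact length_flatMap_range_le fun i _ => by simp
    have l₃ : (initText u (J + 1)).length ≤ (J + 1) * (K₁ * (J + 1)) := by
      refine length_flatMap_range_le fun i hi => (length_text_le _ _ _).trans ?_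
      exact Nat.mul_le_mul (templateCost_le_cellCost _) hi
    have l₅ : ∀ T : Template, ((List.range J).flatMap fun i => T.text G i).length ≤
        J * (templateCost G T * (J + 1)) := fun T =>
      length_flatMap_range_le fun i hi => (length_text_le _ _ _).trans
        (Nat.mul_le_mul_left _ (by omega))
    have l₉ : ((List.range J).flatMap fun _ => List.replicate 4 Sym.tick).length ≤ J * 4 :=
      length_flatMap_range_le fun i _ => by simp
    have l₅' := l₅ (bodyTemplate rules)
    have l₇' := l₅ (finalTemplate done)
    rw [← hK₂] at l₅'
    rw [← hK₃] at l₇'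
    rw [hTT, hT₉, hT₈, hT₇, hT₆, hT₅, hT₄, hT₃, hT₂]
    simp only [List.length_append, unary, List.length_replicate, List.length_cons,
      List.length_nil]
    omega
  rw [hcode]
  have a₁ := does_countInput w
  have a₂ := does_addConst (α := α) c₀ { inp := w, m := w.length }
  have a₃ := does_mulPow (α := α) k { inp := w, m := w.length, c := c₀ } rfl rfl
  have a₄ := does_computeLast (α := α) { inp := w, m := w.length, c := s } rfl rfl
  have a₅ := does_forRange (α := α) (f := fun _ => List.replicate G .tick)
    (S := { inp := w, c := s, j := J }) rfl
    (fun S' _ _ => does_emit (List.replicate G .tick) S')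
  have a₆ := does_emit (α := α) (unary (G + 2) ++ [.seq]) { inp := w, txt := T₁, c := s, j := J }
  simp only [Nat.zero_add, List.nil_append, ← hs, ← hJ, ← hT₁, ← hT₂] at a₂ a₃ a₄ a₅ a₆
  have a₇ := does_emitInit h₁ h₂ h₃ h₄ hJ T₂
  rw [← hT₃] at a₇
  have a₈ := does_loop_j (α := α) (p := .skip) (fun n => { txt := T, j := J - n }) J
    (fun n _ => rfl) (fun n _ => does_skip _)
  simp only [Nat.sub_self, Nat.sub_zero] at a₈
  have b₃ := a₈.seq (does_moveOutput T)
  have b₂ := (hemit _ _ _ hT₈).seq <|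
    (hrange _ _ _ hT₉ fun S' _ _ => does_emit (List.replicate 4 .tick) S').seq <|
    (hemit _ _ _ hTT).seq b₃
  have b₁ := (hemit _ _ _ hT₄).seq <| (hrange _ _ _ hT₅ (hT (bodyTemplate rules))).seq <|
    (hemit _ _ _ hT₆).seq <| (hrange _ _ _ hT₇ (hT (finalTemplate done))).seq b₂
  have b₀ := a₁.seq <| a₂.seq <| a₃.seq <| a₄.seq <| a₅.seq <| a₆.seq <| a₇.seq b₁
  refine Does.mono b₀ ?_
  simp only [List.length_append, unary, List.length_replicate, List.length_cons,
    List.length_nil, timeBound, Nat.cast_id, ← hK₁, ← hK₂, ← hK₃]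
  have p₁ := Nat.zero_le (J * J)
  have p₂ := Nat.zero_le (K₂ * J)
  have p₃ := Nat.zero_le (K₃ * J)
  ring_nf at hlen ⊢
  linarith

end generate

end StackProgram

/-! ### The reduction -/

namespace SpaceBounded

open Turing StackProgram CoreLang CoreLang.Rewriting

/-- The machine computes a bound of the form `c₀ * (m + 1) ^ k` instead of the given polynomial. -/
theorem exists_eval_add_two_le (p : Polynomial ℕ) :
    ∃ c₀ k : ℕ, ∀ m, p.eval m + 2 ≤ c₀ * (m + 1) ^ k := by
  suffices h : ∃ c₀ k : ℕ, ∀ m, p.eval m ≤ c₀ * (m + 1) ^ k by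
    obtain ⟨c₀, k, h⟩ := h
    refine ⟨c₀ + 2, k, fun m => ?_⟩
    have h₁ : 1 ≤ (m + 1) ^ k := Nat.one_le_pow _ _ (Nat.succ_pos m)
    have := h m
    rw [Nat.add_mul]
    omega
  induction p using Polynomial.induction_on' with
  | add p q hp hq =>
    obtain ⟨c₁, k₁, h₁⟩ := hp
    obtain ⟨c₂, k₂, h₂⟩ := hq
    refine ⟨c₁ + c₂, max k₁ k₂, fun m => ?_⟩
    rw [Polynomial.eval_add, Nat.add_mul]
    refine Nat.add_le_add ((h₁ m).trans (Nat.mul_le_mul_left _ ?_))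
      ((h₂ m).trans (Nat.mul_le_mul_left _ ?_))
    · exact Nat.pow_le_pow_right (Nat.succ_pos m) (le_max_left _ _)
    · exact Nat.pow_le_pow_right (Nat.succ_pos m) (le_max_right _ _)
  | monomial n a =>
    refine ⟨a, n, fun m => ?_⟩
    rw [Polynomial.eval_monomial]
    exact Nat.mul_le_mul_left _ (Nat.pow_le_pow_left (Nat.le_succ m) n)

variable {α : Type}

/-- The number of blanks on both sides of the initial word, for inputs of length `m`. -/
def numBlanks {R : Type} [CommSemiring R] (c₀ k : ℕ) (m : R) : R := c₀ * (m + 1) ^ k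

/-- The instance of DEG to which the input `w` of the machine `D` is mapped. -/
noncomputable def Decider.reduction (D : Decider α) (c₀ k : ℕ) (w : List α) : Instance :=
  toInstance (2 * numBlanks c₀ k w.length + w.length) D.rules
    (D.startWord (numBlanks c₀ k w.length) w) .done

/-- The time bound for the computation of the reduction. -/
noncomputable def Decider.reductionTime {R : Type} [CommSemiring R] (D : Decider α) (c₀ k : ℕ)
    (m : R) : R :=
  timeBound c₀ k (Fintype.card (Letter D)) (cellCost (Letter D))
    (templateCost (Fintype.card (Letter D)) (bodyTemplate D.rules))
    (templateCost (Fintype.card (Letter D)) (finalTemplate (Letter.done : Letter D)))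
    m (numBlanks c₀ k m) (2 * numBlanks c₀ k m + m) + 1

theorem Decider.eval_reductionTime (D : Decider α) (c₀ k m : ℕ) :
    (D.reductionTime c₀ k (Polynomial.X : Polynomial ℕ)).eval m = D.reductionTime c₀ k m := by
  simp [reductionTime, timeBound, numBlanks]

/-- The last hypothesis lets the same machine serve for instances and for single-loop instances. -/
theorem Decider.reduction_computable [Fintype α] (D : Decider α) (c₀ k : ℕ) {β : Type}
    (enc : β → List Sym) (f : List α → β) (hf : ∀ w, enc (f w) = (D.reduction c₀ k w).encode) :
    Nonempty (TM2ComputableInPolyTime (fun w : List α => w) enc f) := by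
  refine ⟨⟨⟨(generator c₀ k (D.plain default) .start .done (fun a => D.plain (D.inputSym a))
    D.rules : Prog (StkSym α)).toTM2 .inp .out, Equiv.refl α, Equiv.refl Sym⟩,
    D.reductionTime c₀ k Polynomial.X, fun w => Nonempty.some ?_⟩⟩
  rw [D.eval_reductionTime]
  have hin : (w.map (Equiv.refl α).invFun) = w := List.map_id w
  have hout : ((enc (f w)).map (Equiv.refl Sym).invFun) = (D.reduction c₀ k w).encode := by
    rw [hf]
    exact List.map_id _
  have h := does_generator (c₀ := c₀) (k := k) (w := w) (blank := D.plain default)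
    (start := .start) (done := .done) (letter := fun a => D.plain (D.inputSym a))
    (rules := D.rules) (u := D.startWord (numBlanks c₀ k w.length) w)
    (s := numBlanks c₀ k w.length) rfl rfl ?_ ?_ ?_ ?_
  · have e₁ : ({ inp := w } : Mem α).stk = Function.update (β := fun k => List (StkSym α k))
        (fun _ => []) Stk.inp w := by
      funext k
      cases k <;> rfl
    have e₂ : ({ out := (D.reduction c₀ k w).encode } : Mem α).stk =
        Function.update (β := fun k => List (StkSym α k))
        (fun _ => []) Stk.out (D.reduction c₀ k w).encode := by
      funext k
      cases k <;> rfl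
    have h' : Prog.Runs _ ({ inp := w } : Mem α).stk
      ({ out := (D.reduction c₀ k w).encode } : Mem α).stk _ := h
    rw [e₁, e₂] at h'
    have := Prog.Runs.outputsInTime h'
    erw [hin, hout]
    exact this
  · intro i hi
    simp [Decider.startWord, hi]
  · simp [Decider.startWord]
  · intro i a hia
    rw [Decider.startWord, if_neg (by omega), if_neg (by omega), Nat.add_sub_cancel_left,
      List.getI_eq_getElem?_getD]
    simp [hia]
  · intro i
    rw [Decider.startWord, if_neg (by omega), if_neg (by omega)]
    congr 1
    refine List.getI_eq_default _ ?_
    rw [List.length_map]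
    omega

theorem Decider.loopCount_reduction (D : Decider α) (c₀ k : ℕ) (w : List α) :
    (D.reduction c₀ k w).prog.loopCount = 1 := loopCount_prog _ _ _ _

theorem Decider.mem_iff_reduction_mem_DEG {D : Decider α} {L : Language α} (hL : D.Decides L)
    {c₀ k : ℕ} {p : Polynomial ℕ} (hD : D.RunsInSpace fun m => p.eval m)
    (hp : ∀ m, p.eval m + 2 ≤ c₀ * (m + 1) ^ k) (w : List α) :
    w ∈ L ↔ D.reduction c₀ k w ∈ DEG := by
  have hs : p.eval w.length + 2 ≤ numBlanks c₀ k w.length := hp w.length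
  rw [Decider.reduction, toInstance_mem_DEG_iff (by omega)]
  refine Decider.mem_iff_reaches hL (fun c z h => ?_) (Nat.le_add_right _ _)
  have := hD w c z h
  zify at hs
  push_cast at this
  linarith

end SpaceBounded

/-- DEG is PSPACE-hard, and so is its restriction to the triples whose program contains exactly
one loop (with the degree, like every other number, written in unary). -/
theorem mainTheorem3 :
    SpaceBounded.PSPACEHard CoreLang.Instance.encode CoreLang.DEG ∧
      SpaceBounded.PSPACEHard
        (fun t : CoreLang.SingleLoopInstance => CoreLang.Instance.encode t.1)
        {t : CoreLang.SingleLoopInstance | t.1 ∈ CoreLang.DEG} := by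
  constructor
  · rintro α _ L ⟨D, p, hL, hD⟩
    obtain ⟨c₀, k, hp⟩ := SpaceBounded.exists_eval_add_two_le p
    exact ⟨D.reduction c₀ k, D.reduction_computable c₀ k _ _ fun _ => rfl,
      D.mem_iff_reduction_mem_DEG hL hD hp⟩
  · rintro α _ L ⟨D, p, hL, hD⟩
    obtain ⟨c₀, k, hp⟩ := SpaceBounded.exists_eval_add_two_le p
    exact ⟨fun w => ⟨D.reduction c₀ k w, D.loopCount_reduction c₀ k w⟩,
      D.reduction_computable c₀ k _ _ fun _ => rfl, D.mem_iff_reduction_mem_DEG hL hD hp⟩
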